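/- Let $\Omega\subseteq\mathbb{C}$ be open, let $\beta,\gamma:\Omega\to\mathbb{C}$ be analytic and let $a,b\in\mathbb{C}$. Then the equation $$y''=y^4+(az+b)\,y^2+\beta(z)\,y+\gamma(z)$$ has the quasi-Painlevé property, with cube-root type algebraic poles. That is: let $p:[0,1]\to\Omega$ be a continuous path of finite length with endpoint $z_\ast=p(1)$, and suppose that a local analytic solution $y$ at $p(0)$ can be continued analytically along $p|_{[0,1)}$, but not along $p$ up to and including the endpoint $z_\ast$. Then, near the end of the path, the continued solution is represented by a convergent Puiseux series $$y(z)=\sum_{j=0}^\infty c_j\,(z-z_\ast)^{(j-j_0)/n},\qquad c_0\neq 0,\quad j_0\ge 1,$$ with $n=3$, where $(z-z_\ast)^{1/n}$ denotes a branch of the root that is continued along $p$, the path avoiding $z_\ast$ for all parameters in some interval $[t_0,1)$; and $n=3$ is minimal, i.e. no such representation exists with $n=1$ or $n=2$. -/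

import Mathlib

open Set Filter Topology

/-- `y` is a local analytic solution, near the point `z₀`, of the second-order differential
equation `y'' = F(z, y)`. -/
def IsLocalSolution (F : ℂ → ℂ → ℂ) (y : ℂ → ℂ) (z₀ : ℂ) : Prop :=
  AnalyticAt ℂ y z₀ ∧ ∀ᶠ z in 𝓝 z₀, deriv (deriv y) z = F z (y z)

/-- The family of germs (`f t` at the point `p t`), `0 ≤ t < 1`, is an analytic continuation of
the germ of `f 0` at `p 0` along the half-open path `p|[0,1)`: every germ is analytic, and the
germ at any parameter `s` close to `t` is the one determined by `f t`. -/
def IsAnalyticContinuationAlong (p : ℝ → ℂ) (f : ℝ → ℂ → ℂ) : Prop :=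
  ∀ t ∈ Ico (0 : ℝ) 1, AnalyticAt ℂ (f t) (p t) ∧
    ∀ᶠ s in 𝓝[Ico (0 : ℝ) 1] t, f s =ᶠ[𝓝 (p s)] f t

/-- The analytic continuation `f` along `p|[0,1)` ends in a singularity at the endpoint `p 1`:
it cannot be continued analytically along the whole of `p|[0,1]`. -/
def EndsInSingularity (p : ℝ → ℂ) (f : ℝ → ℂ → ℂ) : Prop :=
  ¬ ∃ g : ℂ → ℂ, AnalyticAt ℂ g (p 1) ∧ ∀ᶠ t in 𝓝[<] (1 : ℝ), f t =ᶠ[𝓝 (p t)] g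

/-- With `z⋆ = p 1`, the continuation `f` along `p|[0,1)` is represented near the end of the path
by a Puiseux series `∑ j, c j * (z - z⋆) ^ ((j - j₀) / n)` with `n, j₀ ≥ 1` and `c 0 ≠ 0`, which
converges for `0 < |z - z⋆| < r ^ n`.  Here `w = (z - z⋆) ^ (1 / n)` is the local branch of the
`n`-th root whose value at `z = p t` is `σ t`; the branch varies continuously along the path. -/
def HasPuiseuxPoleAtEnd (n : ℕ) (p : ℝ → ℂ) (f : ℝ → ℂ → ℂ) : Prop :=
  0 < n ∧ ∃ (j₀ : ℕ) (c : ℕ → ℂ) (r : ℝ), 0 < j₀ ∧ c 0 ≠ 0 ∧ 0 < r ∧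
    (∀ w : ℂ, w ≠ 0 → ‖w‖ < r → Summable fun j : ℕ => c j * w ^ ((j : ℤ) - (j₀ : ℤ))) ∧
    ∃ t₀ ∈ Ico (0 : ℝ) 1, ∃ σ : ℝ → ℂ, ContinuousOn σ (Ico t₀ 1) ∧
      ∀ t ∈ Ico t₀ 1, σ t ≠ 0 ∧ ‖σ t‖ < r ∧ p t = p 1 + σ t ^ n ∧
        ∀ᶠ w in 𝓝 (σ t),
          HasSum (fun j : ℕ => c j * w ^ ((j : ℤ) - (j₀ : ℤ))) (f t (p 1 + w ^ n))

/-- The continuation `f` along `p|[0,1)` has an `n`-th-root type algebraic pole at the endpoint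
`p 1`: it has a Puiseux series representation as above, `n` is minimal, and `n > 1`. -/
def HasRootTypeAlgebraicPoleAtEnd (n : ℕ) (p : ℝ → ℂ) (f : ℝ → ℂ → ℂ) : Prop :=
  1 < n ∧ HasPuiseuxPoleAtEnd n p f ∧ ∀ m < n, ¬ HasPuiseuxPoleAtEnd m p f

/-- The equation `y'' = F(z, y)`, whose coefficients are analytic in the open set `Ω` (so that every
singularity of a solution at a point of `Ω` is movable), has the quasi-Painlevé property with
`n`-th-root type algebraic poles: whenever a local solution, continued analytically along a
continuous path of finite length in `Ω`, runs into a singularity at the endpoint of the path, this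
singularity is an `n`-th-root type algebraic pole. -/
def HasQuasiPainleveProperty (n : ℕ) (Ω : Set ℂ) (F : ℂ → ℂ → ℂ) : Prop :=
  ∀ (p : ℝ → ℂ) (f : ℝ → ℂ → ℂ),
    ContinuousOn p (Icc 0 1) → BoundedVariationOn p (Icc 0 1) → MapsTo p (Icc 0 1) Ω →
    IsAnalyticContinuationAlong p f → IsLocalSolution F (f 0) (p 0) →
    EndsInSingularity p f → HasRootTypeAlgebraicPoleAtEnd n p f

/-!
Let `A = a z + b`, `v = y'` and let `E = v² / 2 - y⁵ / 5 - A y³ / 3 - β y² / 2 - γ y` be the energy.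
Its derivative along a solution is a cubic polynomial in `y`, too large near a pole of `y`. Adding
`c₁ v / y + c₂ v / y² + c₃ v / y³ + c₄ / y` with suitable coefficients (`CoeffJet.correction`) gives
a function `W` with `|W'| ≤ C (1 + |W|)` as long as `|y| ≥ 1`; the only obstruction would come from
the second derivative of `A`, which vanishes. For `|y| ≤ 1` the energy itself has bounded
derivative. A smooth cutoff in `|y|` joins the two: where the cutoff varies, `y` is bounded and its
contribution is at most quadratic in `v`, hence linear in the energy. So the modified energy `G`
satisfies `|G'| ≤ C (1 + |G|)` everywhere (`exists_modEnergy_deriv_bound`) and, the path having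
finite length, stays bounded (`IsSolutionFrom.exists_modEnergy_le`). There is no need to deform the
path away from the zeros of `y`.

If `y` did not tend to infinity, then `(y, v)` would be bounded at parameters arbitrarily close to
the end, and the uniform radius of existence (`exists_uniform_holomorphic_solution`) would continue
the solution past the endpoint. So `y → ∞` (`IsSolutionFrom.tendsto_norm_atTop`), and `v² / y⁵ →
2 / 5`. In the coordinate `u = y ^ (-1 / 2)`, with the root chosen so that `v u⁵ → √(2 / 5)`, the
pair `(z, W)` satisfies as a function of `u` a system that is regular at `u = 0` (`poleField`), with
`dz / du = u² m(u)` and `m(0) ≠ 0`. Its solution through a late state reaches `u = 0`, and there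
`z - z⋆` is the cube of a local coordinate `w`; thus `y = u⁻²` is `w⁻²` times a nonvanishing power
series in `w` (`IsSolutionFrom.hasRootExpansionAtEnd`). An expansion in `w³` or in a square root of
`w³` would have to have the same order of pole, which divisibility by three excludes
(`HasRootExpansionAtEnd.exponent_eq`).
-/

/-! ### Holomorphic differential equations -/

open Metric in
/-- Local uniqueness for complex differential equations: the maximum of `‖φ - ψ‖` over a small
closed disc is at most half of itself. -/
theorem eventuallyEq_of_hasDerivAt_of_lipschitz {E : Type*} [NormedAddCommGroup E]
    [NormedSpace ℂ E] {φ ψ φ' ψ' : ℂ → E} {z₀ : ℂ} {K : ℝ}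
    (hφ : ∀ᶠ z in 𝓝 z₀, HasDerivAt φ (φ' z) z) (hψ : ∀ᶠ z in 𝓝 z₀, HasDerivAt ψ (ψ' z) z)
    (hK : ∀ᶠ z in 𝓝 z₀, ‖φ' z - ψ' z‖ ≤ K * ‖φ z - ψ z‖) (h₀ : φ z₀ = ψ z₀) :
    φ =ᶠ[𝓝 z₀] ψ := by
  obtain ⟨ε, hε, hb⟩ := Metric.eventually_nhds_iff_ball.1 (hφ.and (hψ.and hK))
  set r : ℝ := min (ε / 2) (1 / (2 * (|K| + 1))) with hr
  have hKp : 0 < |K| + 1 := by positivity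
  have hr0 : 0 < r := lt_min (by positivity) (by positivity)
  have hrε : r < ε := (min_le_left _ _).trans_lt (by linarith)
  have hrK : |K| * r ≤ 1 / 2 := by
    have h1 : (|K| + 1) * r ≤ 1 / 2 := by
      calc (|K| + 1) * r ≤ (|K| + 1) * (1 / (2 * (|K| + 1))) := by
            gcongr; exact min_le_right _ _
        _ = 1 / 2 := by field_simp
    nlinarith
  have hsub : closedBall z₀ r ⊆ ball z₀ ε := closedBall_subset_ball hrε
  have hder : ∀ z ∈ closedBall z₀ r, HasDerivAt (fun z => φ z - ψ z) (φ' z - ψ' z) z :=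
    fun z hz => (hb z (hsub hz)).1.sub (hb z (hsub hz)).2.1
  have hcont : ContinuousOn (fun z => ‖φ z - ψ z‖) (closedBall z₀ r) := fun z hz =>
    (hder z hz).continuousAt.norm.continuousWithinAt
  obtain ⟨w, hw, hmax⟩ := (isCompact_closedBall z₀ r).exists_isMaxOn
    ⟨z₀, mem_closedBall_self hr0.le⟩ hcont
  set M : ℝ := ‖φ w - ψ w‖ with hM
  have hle : ∀ z ∈ closedBall z₀ r, ‖φ z - ψ z‖ ≤ M := fun z hz => hmax hz
  have hM2 : M ≤ |K| * M * ‖w - z₀‖ := by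
    have := Convex.norm_image_sub_le_of_norm_hasDerivWithin_le (C := |K| * M)
      (fun z hz => (hder z hz).hasDerivWithinAt)
      (fun z hz => ((hb z (hsub hz)).2.2).trans <| by
        gcongr
        · exact le_abs_self K
        · exact hle z hz)
      (convex_closedBall z₀ r) (mem_closedBall_self hr0.le) hw
    simpa [h₀] using this
  have hwr : ‖w - z₀‖ ≤ r := by simpa [dist_eq_norm] using hw
  have hM0 : M ≤ 0 := by
    have h0 : 0 ≤ M := norm_nonneg _
    have : |K| * M * ‖w - z₀‖ ≤ M * (|K| * r) := by
      calc |K| * M * ‖w - z₀‖ ≤ |K| * M * r := by gcongr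
        _ = _ := by ring
    nlinarith
  filter_upwards [closedBall_mem_nhds z₀ hr0] with z hz
  have := (hle z hz).trans hM0
  exact sub_eq_zero.1 (norm_le_zero_iff.1 this)

open Metric in
/-- Holomorphic Picard–Lindelöf theorem for an autonomous system: the radius of existence is
uniform over the initial values in a neighbourhood, and solutions stay in a prescribed one. -/
theorem exists_uniform_holomorphic_solution {E : Type*} [NormedAddCommGroup E] [NormedSpace ℂ E]
    [CompleteSpace E] {F : E → E} {x₀ : E} (hF : AnalyticAt ℂ F x₀) {U : Set E} (hU : U ∈ 𝓝 x₀) :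
    ∃ ρ > 0, ∃ N ∈ 𝓝 x₀, ∀ x ∈ N, ∃ φ : ℂ → E, φ 0 = x ∧
      ∀ z ∈ ball (0 : ℂ) ρ, HasDerivAt φ (F (φ z)) z ∧ φ z ∈ U := by
  obtain ⟨K, t, ht, hK⟩ := (hF.contDiffAt (n := 1)).exists_lipschitzOnWith
  obtain ⟨R, hR, hRb⟩ := Metric.nhds_basis_closedBall.mem_iff.1
    (inter_mem (inter_mem hU ht) hF.eventually_analyticAt)
  have hRU : closedBall x₀ R ⊆ U := fun x hx => (hRb hx).1.1
  have hRK : LipschitzOnWith K F (closedBall x₀ R) := hK.mono fun x hx => (hRb hx).1.2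
  have hRF : ∀ x ∈ closedBall x₀ R, AnalyticAt ℂ F x := fun x hx => (hRb hx).2
  set M : ℝ := ‖F x₀‖ + K * R + 1 with hM
  have hM0 : 0 < M := by positivity
  have hFM : ∀ x ∈ closedBall x₀ R, ‖F x‖ ≤ M := by
    intro x hx
    have h1 := hRK.norm_sub_le hx (mem_closedBall_self hR.le)
    have h2 : ‖x - x₀‖ ≤ R := by simpa [dist_eq_norm] using hx
    have h3 : (K : ℝ) * ‖x - x₀‖ ≤ K * R := by gcongr
    have h4 := norm_le_norm_add_norm_sub' (F x) (F x₀)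
    linarith
  set ρ : ℝ := min (R / (2 * M)) (1 / (2 * ((K : ℝ) + 1))) with hρ
  have hρ0 : 0 < ρ := lt_min (by positivity) (by positivity)
  have hρM : M * ρ ≤ R / 2 := by
    calc M * ρ ≤ M * (R / (2 * M)) := by gcongr; exact min_le_left _ _
      _ = R / 2 := by field_simp
  have hρK : K * ρ ≤ 1 / 2 := by
    have : ((K : ℝ) + 1) * ρ ≤ 1 / 2 := by
      calc ((K : ℝ) + 1) * ρ ≤ ((K : ℝ) + 1) * (1 / (2 * ((K : ℝ) + 1))) := by
            gcongr; exact min_le_right _ _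
        _ = 1 / 2 := by field_simp
    nlinarith
  refine ⟨ρ, hρ0, ball x₀ (R / 2), ball_mem_nhds _ (by positivity), fun x hx => ?_⟩
  have h0ρ : (0 : ℂ) ∈ ball (0 : ℂ) ρ := mem_ball_self hρ0
  let Good : Set (ℂ → E) :=
    {φ | DifferentiableOn ℂ φ (ball 0 ρ) ∧ MapsTo φ (ball 0 ρ) (closedBall x₀ R) ∧ φ 0 = x}
  have step : ∀ φ : Good, ∃ ψ : Good, ∀ z ∈ ball (0 : ℂ) ρ, HasDerivAt ψ.1 (F (φ.1 z)) z := by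
    rintro ⟨φ, hφd, hφm, hφ0⟩
    have hd : DifferentiableOn ℂ (fun z => F (φ z)) (ball 0 ρ) := fun z hz =>
      ((hRF _ (hφm hz)).differentiableAt.comp_differentiableWithinAt z (hφd z hz))
    obtain ⟨ψ, hψ0, hψ⟩ := hd.isExactOn_ball.with_val_at 0 x
    refine ⟨⟨ψ, fun z hz => (hψ z hz).differentiableAt.differentiableWithinAt, ?_, hψ0⟩, hψ⟩
    intro z hz
    have h1 := Convex.norm_image_sub_le_of_norm_hasDerivWithin_le (C := M)
      (fun z hz => (hψ z hz).hasDerivWithinAt) (fun z hz => hFM _ (hφm hz))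
      (convex_ball (0 : ℂ) ρ) h0ρ hz
    have h2 : ‖z‖ < ρ := by simpa using hz
    have h3 : ‖x - x₀‖ < R / 2 := by simpa [dist_eq_norm] using hx
    rw [hψ0, sub_zero] at h1
    have h4 : M * ‖z‖ ≤ M * ρ := by gcongr
    rw [mem_closedBall, dist_eq_norm]
    calc ‖ψ z - x₀‖ = ‖(ψ z - x) + (x - x₀)‖ := by congr 1; abel
      _ ≤ ‖ψ z - x‖ + ‖x - x₀‖ := norm_add_le _ _
      _ ≤ R := by linarith
  -- Picard iteration; consecutive iterates differ by at most `2 R / 2 ^ n`.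
  choose T hT using step
  let s : ℕ → Good := fun n => T^[n] ⟨fun _ => x, differentiableOn_const _, fun _ _ =>
    ball_subset_closedBall (ball_subset_ball (by linarith) hx), rfl⟩
  have hs : ∀ n, s (n + 1) = T (s n) := fun n => Function.iterate_succ_apply' _ _ _
  have hsd : ∀ n, ∀ z ∈ ball (0 : ℂ) ρ, HasDerivAt (s (n + 1)).1 (F ((s n).1 z)) z := by
    intro n z hz
    rw [hs]
    exact hT _ z hz
  have hstep : ∀ n, ∀ z ∈ ball (0 : ℂ) ρ,
      dist ((s n).1 z) ((s (n + 1)).1 z) ≤ 4 * R / 2 / 2 ^ n := by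
    intro n
    induction n with
    | zero =>
      intro z hz
      have h1 := (s 0).2.2.1 hz
      have h2 := (s 1).2.2.1 hz
      rw [mem_closedBall] at h1 h2
      have := dist_triangle_right ((s 0).1 z) ((s 1).1 z) x₀
      simp only [pow_zero, div_one, zero_add]
      linarith
    | succ n ih =>
      intro z hz
      rw [dist_comm, dist_eq_norm]
      have h1 := Convex.norm_image_sub_le_of_norm_hasDerivWithin_le
        (f := fun z => (s (n + 2)).1 z - (s (n + 1)).1 z) (C := K * (4 * R / 2 / 2 ^ n))
        (fun z hz => ((hsd (n + 1) z hz).sub (hsd n z hz)).hasDerivWithinAt)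
        (fun z hz => by
          have h2 := hRK.norm_sub_le ((s (n + 1)).2.2.1 hz) ((s n).2.2.1 hz)
          refine h2.trans ?_
          gcongr
          rw [← dist_eq_norm, dist_comm]
          exact ih z hz)
        (convex_ball (0 : ℂ) ρ) h0ρ hz
      simp only [(s (n + 2)).2.2.2, (s (n + 1)).2.2.2, sub_self, sub_zero] at h1
      have h2 : ‖z‖ ≤ ρ := by
        have : ‖z‖ < ρ := by simpa using hz
        exact this.le
      calc _ ≤ K * (4 * R / 2 / 2 ^ n) * ‖z‖ := h1
        _ ≤ K * (4 * R / 2 / 2 ^ n) * ρ := by gcongr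
        _ = (K * ρ) * (4 * R / 2 / 2 ^ n) := by ring
        _ ≤ 1 / 2 * (4 * R / 2 / 2 ^ n) := by gcongr
        _ = _ := by rw [pow_succ]; field_simp
  have hlim : ∀ z : ℂ, ∃ l, z ∈ ball (0 : ℂ) ρ → Tendsto (fun n => (s n).1 z) atTop (𝓝 l) := by
    intro z
    by_cases hz : z ∈ ball (0 : ℂ) ρ
    · obtain ⟨l, hl⟩ := cauchySeq_tendsto_of_complete
        (cauchySeq_of_le_geometric_two (fun n => hstep n z hz))
      exact ⟨l, fun _ => hl⟩
    · exact ⟨0, fun h => absurd h hz⟩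
  choose φ hφ using hlim
  have hunif : TendstoUniformlyOn (fun n => (s n).1) φ atTop (ball 0 ρ) := by
    rw [Metric.tendstoUniformlyOn_iff]
    intro ε hε
    have : Tendsto (fun n : ℕ => 4 * R / 2 ^ n) atTop (𝓝 0) :=
      tendsto_const_nhds.div_atTop (tendsto_pow_atTop_atTop_of_one_lt one_lt_two)
    filter_upwards [this.eventually_lt_const hε] with n hn z hz
    rw [dist_comm]
    exact (dist_le_of_le_geometric_two_of_tendsto (fun n => hstep n z hz) (hφ z hz) n).trans_lt hn
  have hsdiff : ∀ n, DifferentiableOn ℂ (s n).1 (ball 0 ρ) := fun n => (s n).2.1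
  have hφm : ∀ z ∈ ball (0 : ℂ) ρ, φ z ∈ closedBall x₀ R := fun z hz =>
    isClosed_closedBall.mem_of_tendsto (hφ z hz) (Eventually.of_forall fun n => (s n).2.2.1 hz)
  refine ⟨φ, tendsto_nhds_unique (hφ 0 h0ρ) ?_, fun z hz => ⟨?_, hRU (hφm z hz)⟩⟩
  · simp only [(s _).2.2.2]
    exact tendsto_const_nhds
  have hdiff : DifferentiableOn ℂ φ (ball 0 ρ) :=
    hunif.tendstoLocallyUniformlyOn.differentiableOn (Eventually.of_forall hsdiff) isOpen_ball
  have hderiv := ((hunif.tendstoLocallyUniformlyOn.deriv (Eventually.of_forall hsdiff)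
    isOpen_ball).tendsto_at hz).comp (tendsto_add_atTop_nat 1)
  have heq : deriv φ z = F (φ z) := by
    refine tendsto_nhds_unique hderiv ?_
    have h1 : Tendsto (fun n => F ((s n).1 z)) atTop (𝓝 (F (φ z))) :=
      ((hRF _ (hφm z hz)).continuousAt.tendsto).comp (hφ z hz)
    refine h1.congr fun n => ?_
    exact ((hsd n z hz).deriv).symm
  rw [← heq]
  exact (hdiff.differentiableAt (isOpen_ball.mem_nhds hz)).hasDerivAt

/-! ### Analytic continuation along a path and paths of finite length -/

/-- The germs of `f t` at `p t`, for `t₀ ≤ t < 1`, form an analytic continuation along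
`p|[t₀,1)`. -/
def IsContinuationFrom {E : Type*} [NormedAddCommGroup E] [NormedSpace ℂ E] (t₀ : ℝ) (p : ℝ → ℂ)
    (f : ℝ → ℂ → E) : Prop :=
  ∀ t ∈ Ico t₀ 1, AnalyticAt ℂ (f t) (p t) ∧
    ∀ᶠ s in 𝓝[Ico t₀ 1] t, f s =ᶠ[𝓝 (p s)] f t

namespace IsContinuationFrom

variable {E : Type*} [NormedAddCommGroup E] [NormedSpace ℂ E] {t₀ : ℝ} {p : ℝ → ℂ}
  {f g : ℝ → ℂ → E}

theorem mono (hf : IsContinuationFrom t₀ p f) {t₁ : ℝ} (h : t₀ ≤ t₁) :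
    IsContinuationFrom t₁ p f := fun t ht =>
  have hs : Ico t₁ 1 ⊆ Ico t₀ 1 := Ico_subset_Ico_left h
  ⟨(hf t (hs ht)).1, (hf t (hs ht)).2.filter_mono (nhdsWithin_mono _ hs)⟩

theorem continuousOn (hf : IsContinuationFrom t₀ p f) (hp : ContinuousOn p (Ico t₀ 1)) :
    ContinuousOn (fun t => f t (p t)) (Ico t₀ 1) := by
  intro t ht
  have h1 : ContinuousWithinAt (fun s => f t (p s)) (Ico t₀ 1) t :=
    (hf t ht).1.continuousAt.comp_continuousWithinAt (hp t ht)
  refine h1.congr_of_eventuallyEq ?_ rfl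
  filter_upwards [(hf t ht).2] with s hs using hs.eq_of_nhds

/-- Uniqueness of analytic continuation along a path. -/
theorem eventuallyEq [CompleteSpace E] (hf : IsContinuationFrom t₀ p f)
    (hg : IsContinuationFrom t₀ p g)
    (hp : ContinuousOn p (Ico t₀ 1)) {t₁ : ℝ} (ht₁ : t₁ ∈ Ico t₀ 1)
    (h : f t₁ =ᶠ[𝓝 (p t₁)] g t₁) {t : ℝ} (ht : t ∈ Ico t₀ 1) : f t =ᶠ[𝓝 (p t)] g t := by
  refine isPreconnected_Ico.induction₂'
    (fun s t => f s =ᶠ[𝓝 (p s)] g s → f t =ᶠ[𝓝 (p t)] g t) ?_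
    (fun x y z _ _ _ hxy hyz hx => hyz (hxy hx)) ht₁ ht h
  intro t ht
  obtain ⟨ε, hε, hb⟩ := Metric.eventually_nhds_iff_ball.1
    ((hf t ht).1.eventually_analyticAt.and (hg t ht).1.eventually_analyticAt)
  have hfb : AnalyticOnNhd ℂ (f t) (Metric.ball (p t) ε) := fun z hz => (hb z hz).1
  have hgb : AnalyticOnNhd ℂ (g t) (Metric.ball (p t) ε) := fun z hz => (hb z hz).2
  have hball : ∀ᶠ s in 𝓝[Ico t₀ 1] t, p s ∈ Metric.ball (p t) ε :=
    (hp t ht) (Metric.ball_mem_nhds _ hε)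
  have key : ∀ w ∈ Metric.ball (p t) ε, ∀ w' ∈ Metric.ball (p t) ε,
      f t =ᶠ[𝓝 w] g t → f t =ᶠ[𝓝 w'] g t := fun w hw w' hw' h =>
    (hfb.eqOn_of_preconnected_of_eventuallyEq hgb (convex_ball _ _).isPreconnected hw
      h).eventuallyEq_of_mem (Metric.isOpen_ball.mem_nhds hw')
  have ht' := Metric.mem_ball_self (x := p t) hε
  filter_upwards [hball, (hf t ht).2, (hg t ht).2] with s hs hfs hgs
  exact ⟨fun h => (hfs.trans (key _ ht' _ hs h)).trans hgs.symm,
    fun h => key _ hs _ ht' ((hfs.symm.trans h).trans hgs)⟩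

end IsContinuationFrom

theorem IsContinuationFrom.deriv {t₀ : ℝ} {p : ℝ → ℂ} {f : ℝ → ℂ → ℂ}
    (hf : IsContinuationFrom t₀ p f) :
    IsContinuationFrom t₀ p (fun t => deriv (f t)) := fun t ht =>
  ⟨(hf t ht).1.deriv, (hf t ht).2.mono fun _ hs => hs.deriv⟩

open scoped ENNReal in
/-- A function that is locally Lipschitz with respect to a path of finite length changes by at most
the Lipschitz constant times that length. -/
theorem abs_sub_le_variation_of_locally {g : ℝ → ℝ} {p : ℝ → ℂ} {a b C : ℝ} (hC : 0 ≤ C)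
    (hab : a ≤ b) {S : Set ℝ} (hS : Icc a b ⊆ S) (hp : BoundedVariationOn p S)
    (h : ∀ t ∈ Icc a b, ∃ O ∈ 𝓝[Icc a b] t, ∀ s ∈ O, ∀ s' ∈ O, |g s - g s'| ≤ C * ‖p s - p s'‖) :
    |g b - g a| ≤ C * (eVariationOn p S).toReal := by
  have h' : ∀ t : Icc a b, ∃ O : Set (Icc a b), IsOpen O ∧ t ∈ O ∧
      ∀ s ∈ O, ∀ s' ∈ O, |g s - g s'| ≤ C * ‖p s - p s'‖ := by
    rintro ⟨t, ht⟩
    obtain ⟨O, hO, hOb⟩ := h t ht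
    rw [mem_nhdsWithin] at hO
    obtain ⟨V, hV, htV, hVO⟩ := hO
    refine ⟨(Subtype.val ⁻¹' V : Set (Icc a b)), hV.preimage continuous_subtype_val, htV, fun s hs s' hs' => ?_⟩
    exact hOb _ (hVO ⟨hs, s.2⟩) _ (hVO ⟨hs', s'.2⟩)
  choose O hO htO hOb using h'
  obtain ⟨u, hu0, hum, ⟨m, hm⟩, hu⟩ := exists_monotone_Icc_subset_open_cover_Icc hab hO
    (fun t _ => mem_iUnion.2 ⟨t, htO t⟩)
  have hsum : ∀ n, |g (u n) - g a| ≤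
      C * ∑ i ∈ Finset.range n, ‖p (u (i + 1)) - p (u i)‖ := by
    intro n
    induction n with
    | zero => simp [hu0]
    | succ n ih =>
      obtain ⟨i, hi⟩ := hu n
      have h1 := hOb i _ (hi ⟨hum n.le_succ, le_rfl⟩) _ (hi ⟨le_rfl, hum n.le_succ⟩)
      rw [Finset.sum_range_succ, mul_add]
      have := abs_sub_le (g (u (n + 1))) (g (u n)) (g a)
      linarith
  have hle := hsum m
  rw [hm m le_rfl] at hle
  refine hle.trans ?_
  gcongr
  have h2 := eVariationOn.sum_le (f := p) (s := S) (n := m) (u := fun n => (u n : ℝ))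
    (fun i j hij => hum hij) (fun i => hS (u i).2)
  have h3 := ENNReal.toReal_mono hp h2
  rw [ENNReal.toReal_sum (fun _ _ => edist_ne_top _ _)] at h3
  simpa only [edist_dist, dist_eq_norm, ENNReal.toReal_ofReal (norm_nonneg _)] using h3

/-! ### The energy, its correction, and pointwise estimates -/

/-- The values at one point of `a`, of `A = a z + b`, and of `β` and `γ` with their derivatives
of the orders that enter the modified energy and its derivative. -/
structure CoeffJet where
  (a A β β₁ β₂ β₃ γ γ₁ γ₂ : ℂ)

namespace CoeffJet

variable (J : CoeffJet)

/-- The right-hand side of the equation. -/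
noncomputable def rhs (y : ℂ) : ℂ := y ^ 4 + J.A * y ^ 2 + J.β * y + J.γ

/-- The energy of the equation with its coefficients frozen; `v` stands for `y'`. -/
noncomputable def energy (y v : ℂ) : ℂ :=
  v ^ 2 / 2 - y ^ 5 / 5 - J.A * y ^ 3 / 3 - J.β * y ^ 2 / 2 - J.γ * y

/-- The coefficient of `v / y` in the correction. -/
noncomputable def c₁ : ℂ := 5 / 9 * J.a
/-- The coefficient of `v / y ^ 2` in the correction. -/
noncomputable def c₂ : ℂ := 5 / 2 * J.β₁
/-- The coefficient of `v / y ^ 3` in the correction. -/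
noncomputable def c₃ : ℂ := 5 * (J.c₁ * J.A / 3 - J.γ₁)
/-- The coefficient of `1 / y` in the correction. -/
noncomputable def c₄ : ℂ := 5 / 2 * J.β₂
/-- The derivative of the coefficient `c₃`. -/
noncomputable def c₃' : ℂ := 5 * (J.c₁ * J.a / 3 - J.γ₂)
/-- The derivative of the coefficient `c₄`. -/
noncomputable def c₄' : ℂ := 5 / 2 * J.β₃

/-- The terms added to the energy far from the zeros of `y`. Modulo terms that are bounded in terms
of the corrected energy, their derivatives cancel the powers `y ^ 3`, `y ^ 2` and `y` in the
derivative of the energy. That `A' = a` is constant is what makes this possible: otherwise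
`A'' * (v / y)`, a multiple of the derivative of `log y`, would remain, and no term that is a power
of `y` could compensate it. -/
noncomputable def correction (y v : ℂ) : ℂ :=
  J.c₁ * (v / y) + J.c₂ * (v / y ^ 2) + J.c₃ * (v / y ^ 3) + J.c₄ * (1 / y)

/-- The derivative of `energy` along a solution. -/
noncomputable def energyDeriv (y : ℂ) : ℂ := -(J.a * y ^ 3 / 3) - J.β₁ * y ^ 2 / 2 - J.γ₁ * y

/-- The derivative of `correction` along a solution; `c₁` is constant and `c₂' = c₄`. -/
noncomputable def correctionDeriv (y v : ℂ) : ℂ :=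
  J.c₁ * (J.rhs y / y - v ^ 2 / y ^ 2) +
    (J.c₄ * (v / y ^ 2) + J.c₂ * (J.rhs y / y ^ 2 - 2 * v ^ 2 / y ^ 3)) +
    (J.c₃' * (v / y ^ 3) + J.c₃ * (J.rhs y / y ^ 3 - 3 * v ^ 2 / y ^ 4)) +
    (J.c₄' * (1 / y) - J.c₄ * (v / y ^ 2))

/-- The derivative of `energy + correction` along a solution, in the variables
`i = 1 / y`, `e = energy / y ^ 2` and `x = v / y ^ 3`. -/
noncomputable def remainder (i e x : ℂ) : ℂ :=
  J.c₁ * (-(J.γ * i) - 2 * e) + J.c₂ * (-(J.A * (1 / 3)) - J.β * i - 3 * (J.γ * i ^ 2) - 4 * (e * i))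
    + J.c₃ * (-(J.A * i) - 2 * (J.β * i ^ 2) - 5 * (J.γ * i ^ 3) - 6 * (e * i ^ 2))
    + J.c₃' * x + J.c₄' * i

theorem energyDeriv_add_correctionDeriv {y : ℂ} (hy : y ≠ 0) (v : ℂ) :
    J.energyDeriv y + J.correctionDeriv y v =
      J.remainder (1 / y) (J.energy y v / y ^ 2) (v / y ^ 3) := by
  simp only [energyDeriv, correctionDeriv, remainder, energy, rhs, c₁, c₂, c₃, c₄]
  field_simp
  ring

/-- All the coefficients that occur are bounded by `M`. -/
structure BoundedBy (M : ℝ) : Prop where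
  one_le : 1 ≤ M
  a : ‖J.a‖ ≤ M
  A : ‖J.A‖ ≤ M
  β : ‖J.β‖ ≤ M
  β₁ : ‖J.β₁‖ ≤ M
  γ : ‖J.γ‖ ≤ M
  γ₁ : ‖J.γ₁‖ ≤ M
  c₁ : ‖J.c₁‖ ≤ M
  c₂ : ‖J.c₂‖ ≤ M
  c₃ : ‖J.c₃‖ ≤ M
  c₄ : ‖J.c₄‖ ≤ M
  c₃' : ‖J.c₃'‖ ≤ M
  c₄' : ‖J.c₄'‖ ≤ M

variable {J} {M : ℝ}

theorem norm_correction_le (h : J.BoundedBy M) {y : ℂ} (hy : 1 ≤ ‖y‖) (v : ℂ) :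
    ‖J.correction y v‖ ≤ 3 * M * ‖v‖ + M := by
  have hM := zero_le_one.trans h.one_le
  have hpow : ∀ k, ‖v / y ^ k‖ ≤ ‖v‖ := fun k => by
    rw [norm_div, norm_pow]
    exact div_le_self (norm_nonneg _) (one_le_pow₀ hy)
  have h1 : ‖v / y‖ ≤ ‖v‖ := by simpa using hpow 1
  have hi : ‖1 / y‖ ≤ 1 := by
    rw [norm_div, norm_one]
    exact div_le_self zero_le_one hy
  have := norm_add_le_of_le (norm_add_le_of_le (norm_add_le_of_le
    (norm_mul_le_of_le h.c₁ h1) (norm_mul_le_of_le h.c₂ (hpow 2)))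
    (norm_mul_le_of_le h.c₃ (hpow 3))) (norm_mul_le_of_le h.c₄ hi)
  refine this.trans (le_of_eq ?_)
  ring

/-- The velocity is controlled by the (partially) corrected energy and by the position. -/
theorem norm_sq_le (h : J.BoundedBy M) {κ y v : ℂ} {Y : ℝ} (hY : 1 ≤ Y) (hy : ‖y‖ ≤ Y)
    (hκ : ‖κ‖ ≤ 1) (hκ0 : ‖y‖ < 1 → κ = 0) :
    ‖v‖ ^ 2 ≤ 4 * (1 + 4 * M + 9 * M ^ 2) *
      (‖J.energy y v + κ * J.correction y v‖ + Y ^ 5) := by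
  have hM := zero_le_one.trans h.one_le
  have hY0 : 0 ≤ Y := zero_le_one.trans hY
  set G := J.energy y v + κ * J.correction y v with hG
  have hcorr : ‖κ * J.correction y v‖ ≤ 3 * M * ‖v‖ + M := by
    rcases lt_or_ge ‖y‖ 1 with h1 | h1
    · rw [hκ0 h1, zero_mul, norm_zero]
      positivity
    · exact (norm_mul_le_of_le hκ (norm_correction_le h h1 v)).trans (by rw [one_mul])
  have hpow : ∀ k ≤ 5, ‖y ^ k‖ ≤ Y ^ 5 := fun k hk => by
    rw [norm_pow]
    exact (pow_le_pow_left₀ (norm_nonneg _) hy k).trans (pow_le_pow_right₀ hY hk)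
  have hy1 : ‖y‖ ≤ Y ^ 5 := by simpa using hpow 1 (by norm_num)
  have hv : v ^ 2 = 2 * (G + (1 / 5) * y ^ 5 + (1 / 3) * (J.A * y ^ 3) + (1 / 2) * (J.β * y ^ 2)
      + J.γ * y - κ * J.correction y v) := by
    rw [hG, energy]
    ring
  have hv2 : ‖v‖ ^ 2 ≤ 2 * (‖G‖ + 1 / 5 * Y ^ 5 + 1 / 3 * (M * Y ^ 5) + 1 / 2 * (M * Y ^ 5)
      + M * Y ^ 5 + (3 * M * ‖v‖ + M)) := by
    rw [← norm_pow, hv]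
    refine norm_mul_le_of_le (by norm_num) (norm_sub_le_of_le (norm_add_le_of_le (norm_add_le_of_le
      (norm_add_le_of_le (norm_add_le_of_le le_rfl (norm_mul_le_of_le (by norm_num)
      (hpow 5 le_rfl)))
      (norm_mul_le_of_le (by norm_num) (norm_mul_le_of_le h.A (hpow 3 (by norm_num)))))
      (norm_mul_le_of_le (by norm_num) (norm_mul_le_of_le h.β (hpow 2 (by norm_num)))))
      (norm_mul_le_of_le h.γ hy1)) hcorr)
  have hY5 : 1 ≤ Y ^ 5 := one_le_pow₀ hY
  have h1 : M * 1 ≤ M * Y ^ 5 := by gcongr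
  have h2 : M ^ 2 * 1 ≤ M ^ 2 * Y ^ 5 := by gcongr
  have h3 : 0 ≤ M * ‖G‖ := by positivity
  have h4 : 0 ≤ M ^ 2 * ‖G‖ := by positivity
  nlinarith [sq_nonneg (‖v‖ - 6 * M), norm_nonneg G]

/-- Far from the zeros of `y` the corrected energy `G` satisfies `|G'| ≤ C (1 + |G|)`. -/
theorem norm_remainder_le (h : J.BoundedBy M) {y : ℂ} (hy : 1 ≤ ‖y‖) (v : ℂ) :
    ‖J.remainder (1 / y) (J.energy y v / y ^ 2) (v / y ^ 3)‖ ≤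
      (15 * M ^ 2) * ((2 + 4 * M) * (3 + 4 * (1 + 4 * M + 9 * M ^ 2))) *
        (1 + ‖J.energy y v + J.correction y v‖) := by
  have hM1 := h.one_le
  have hM := zero_le_one.trans h.one_le
  set G := J.energy y v + J.correction y v with hG
  have hypos : 0 < ‖y‖ := by linarith
  have hy0 : y ≠ 0 := norm_pos_iff.1 hypos
  set C₀ := 4 * (1 + 4 * M + 9 * M ^ 2) with hC₀
  have hC₀0 : 0 ≤ C₀ := by positivity
  have hv := norm_sq_le h (κ := 1) (v := v) hy le_rfl (by simp) (fun h => absurd h (not_lt.2 hy))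
  rw [one_mul, ← hG, ← hC₀] at hv
  have hx : ‖v / y ^ 3‖ ≤ 1 + C₀ * (‖G‖ + 1) := by
    have h1 : ‖v / y ^ 3‖ ^ 2 ≤ C₀ * (‖G‖ + 1) := by
      rw [norm_div, norm_pow, div_pow, div_le_iff₀ (by positivity)]
      refine hv.trans ?_
      refine (mul_le_mul_of_nonneg_left ?_ hC₀0).trans_eq (mul_assoc _ _ _).symm
      have h5 : ‖y‖ ^ 5 ≤ (‖y‖ ^ 3) ^ 2 := by
        rw [← pow_mul]
        exact pow_le_pow_right₀ hy (by norm_num)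
      have h6 : 1 ≤ (‖y‖ ^ 3) ^ 2 := one_le_pow₀ (one_le_pow₀ hy)
      nlinarith [norm_nonneg G]
    nlinarith [sq_nonneg (‖v / y ^ 3‖ - 1), norm_nonneg (v / y ^ 3)]
  have hi : ‖1 / y‖ ≤ 1 := by
    rw [norm_div, norm_one]
    exact div_le_self zero_le_one hy
  have hik : ∀ k, ‖(1 / y) ^ k‖ ≤ 1 := fun k => by
    rw [norm_pow]
    exact pow_le_one₀ (norm_nonneg _) hi
  have he : ‖J.energy y v / y ^ 2‖ ≤ ‖G‖ + 3 * M * ‖v / y ^ 3‖ + M := by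
    have hEq : J.energy y v / y ^ 2 = G * (1 / y) ^ 2 - (J.c₁ * (v / y ^ 3)
        + J.c₂ * (v / y ^ 3 * (1 / y)) + J.c₃ * (v / y ^ 3 * (1 / y) ^ 2)
        + J.c₄ * (1 / y) ^ 3) := by
      rw [hG, correction]
      field_simp
      ring
    rw [hEq]
    have := norm_sub_le_of_le (norm_mul_le_of_le (le_refl ‖G‖) (hik 2))
      (norm_add_le_of_le (norm_add_le_of_le (norm_add_le_of_le
        (norm_mul_le_of_le h.c₁ (le_refl ‖v / y ^ 3‖))
        (norm_mul_le_of_le h.c₂ (norm_mul_le_of_le (le_refl ‖v / y ^ 3‖) hi)))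
        (norm_mul_le_of_le h.c₃ (norm_mul_le_of_le (le_refl ‖v / y ^ 3‖) (hik 2))))
        (norm_mul_le_of_le h.c₄ (hik 3)))
    refine this.trans (le_of_eq ?_)
    ring
  set e := J.energy y v / y ^ 2
  set x := v / y ^ 3
  set i := 1 / y
  have n3 : ‖(1 / 3 : ℂ)‖ ≤ 1 := by norm_num
  have m2 : ‖(2 : ℂ)‖ ≤ 2 := by norm_num
  have m3 : ‖(3 : ℂ)‖ ≤ 3 := by norm_num
  have m4 : ‖(4 : ℂ)‖ ≤ 4 := by norm_num
  have m5 : ‖(5 : ℂ)‖ ≤ 5 := by norm_num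
  have m6 : ‖(6 : ℂ)‖ ≤ 6 := by norm_num
  have ee := le_refl ‖e‖
  have hneg : ∀ {w : ℂ} {r : ℝ}, ‖w‖ ≤ r → ‖-w‖ ≤ r := fun h => by rwa [norm_neg]
  have hR : ‖J.remainder i e x‖ ≤ 15 * M ^ 2 * (1 + ‖e‖ + ‖x‖) := by
    have := norm_add_le_of_le (norm_add_le_of_le (norm_add_le_of_le (norm_add_le_of_le
      (norm_mul_le_of_le h.c₁ (norm_sub_le_of_le (hneg (norm_mul_le_of_le h.γ hi))
        (norm_mul_le_of_le m2 ee)))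
      (norm_mul_le_of_le h.c₂ (norm_sub_le_of_le (norm_sub_le_of_le (norm_sub_le_of_le
        (hneg (norm_mul_le_of_le h.A n3)) (norm_mul_le_of_le h.β hi))
        (norm_mul_le_of_le m3 (norm_mul_le_of_le h.γ (hik 2))))
        (norm_mul_le_of_le m4 (norm_mul_le_of_le ee hi)))))
      (norm_mul_le_of_le h.c₃ (norm_sub_le_of_le (norm_sub_le_of_le (norm_sub_le_of_le
        (hneg (norm_mul_le_of_le h.A hi)) (norm_mul_le_of_le m2 (norm_mul_le_of_le h.β (hik 2))))
        (norm_mul_le_of_le m5 (norm_mul_le_of_le h.γ (hik 3))))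
        (norm_mul_le_of_le m6 (norm_mul_le_of_le ee (hik 2))))))
      (norm_mul_le_of_le h.c₃' (le_refl ‖x‖)))
      (norm_mul_le_of_le h.c₄' hi)
    refine this.trans ?_
    have h1 : M * 1 ≤ M * M := by gcongr
    have h2 : M * ‖e‖ ≤ M * M * ‖e‖ := by
      gcongr
      linarith
    have h3 : M * ‖x‖ ≤ M * M * ‖x‖ := by
      gcongr
      linarith
    have h4 : 0 ≤ M * M * ‖e‖ := by positivity
    have h5 : 0 ≤ M * M * ‖x‖ := by positivity
    nlinarith
  refine hR.trans ?_
  rw [mul_assoc (15 * M ^ 2)]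
  gcongr
  have hG0 := norm_nonneg G
  have hx' : ‖x‖ ≤ (1 + C₀) * (1 + ‖G‖) := by nlinarith
  have h7 : 3 * M * ‖x‖ ≤ 3 * M * ((1 + C₀) * (1 + ‖G‖)) := by gcongr
  have h8 : 0 ≤ M * ((1 + C₀) * (1 + ‖G‖)) := by positivity
  have h9 : 0 ≤ C₀ * ‖G‖ := by positivity
  have h10 : M * 1 ≤ M * (1 + ‖G‖) := by gcongr; linarith
  have h11 : 0 ≤ M * (1 + ‖G‖) := by positivity
  have h12 : 0 ≤ M * C₀ * (1 + ‖G‖) := by positivity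
  nlinarith

theorem norm_energyDeriv_le (h : J.BoundedBy M) {y : ℂ} (hy : ‖y‖ ≤ 2) :
    ‖J.energyDeriv y‖ ≤ 7 * M := by
  have hM := zero_le_one.trans h.one_le
  have hy2 : ‖y ^ 2‖ ≤ 2 ^ 2 := by
    rw [norm_pow]
    gcongr
  have hy3 : ‖y ^ 3‖ ≤ 2 ^ 3 := by
    rw [norm_pow]
    gcongr
  have heq : J.energyDeriv y =
      -(1 / 3 * (J.a * y ^ 3) + 1 / 2 * (J.β₁ * y ^ 2) + J.γ₁ * y) := by
    rw [energyDeriv]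
    ring
  have n3 : ‖(1 / 3 : ℂ)‖ ≤ 1 / 3 := by norm_num
  have n2 : ‖(1 / 2 : ℂ)‖ ≤ 1 / 2 := by norm_num
  rw [heq, norm_neg]
  refine (norm_add_le_of_le (norm_add_le_of_le
    (norm_mul_le_of_le n3 (norm_mul_le_of_le h.a hy3))
    (norm_mul_le_of_le n2 (norm_mul_le_of_le h.β₁ hy2))) (norm_mul_le_of_le h.γ₁ hy)).trans ?_
  linarith

theorem norm_correctionDeriv_le (h : J.BoundedBy M) {y : ℂ} (hy1 : 1 ≤ ‖y‖) (hy : ‖y‖ ≤ 2)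
    (v : ℂ) : ‖J.correctionDeriv y v‖ ≤ 73 * M ^ 2 * (1 + ‖v‖ ^ 2) := by
  have hM1 := h.one_le
  have hM := zero_le_one.trans hM1
  have hy2 : ‖y ^ 2‖ ≤ 2 ^ 2 := by
    rw [norm_pow]
    gcongr
  have hy4 : ‖y ^ 4‖ ≤ 2 ^ 4 := by
    rw [norm_pow]
    gcongr
  have hF : ‖J.rhs y‖ ≤ 23 * M := by
    refine (norm_add_le_of_le (norm_add_le_of_le (norm_add_le_of_le hy4
      (norm_mul_le_of_le h.A hy2)) (norm_mul_le_of_le h.β hy)) h.γ).trans ?_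
    linarith
  have hdiv : ∀ {w : ℂ} {r : ℝ} (k : ℕ), ‖w‖ ≤ r → ‖w / y ^ k‖ ≤ r := fun k hw => by
    rw [norm_div, norm_pow]
    exact (div_le_self (norm_nonneg _) (one_le_pow₀ hy1)).trans hw
  have hdiv1 : ∀ {w : ℂ} {r : ℝ}, ‖w‖ ≤ r → ‖w / y‖ ≤ r := fun hw => by
    simpa using hdiv 1 hw
  have hv := le_refl ‖v‖
  have hv2 : ‖v ^ 2‖ ≤ ‖v‖ ^ 2 := (norm_pow v 2).le
  have m2 : ‖(2 : ℂ)‖ ≤ 2 := by norm_num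
  have m3 : ‖(3 : ℂ)‖ ≤ 3 := by norm_num
  have m1 : ‖(1 : ℂ)‖ ≤ 1 := by norm_num
  refine (norm_add_le_of_le (norm_add_le_of_le (norm_add_le_of_le
    (norm_mul_le_of_le h.c₁ (norm_sub_le_of_le (hdiv1 hF) (hdiv 2 hv2)))
    (norm_add_le_of_le (norm_mul_le_of_le h.c₄ (hdiv 2 hv)) (norm_mul_le_of_le h.c₂
      (norm_sub_le_of_le (hdiv 2 hF) (hdiv 3 (norm_mul_le_of_le m2 hv2))))))
    (norm_add_le_of_le (norm_mul_le_of_le h.c₃' (hdiv 3 hv)) (norm_mul_le_of_le h.c₃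
      (norm_sub_le_of_le (hdiv 3 hF) (hdiv 4 (norm_mul_le_of_le m3 hv2))))))
    (norm_sub_le_of_le (norm_mul_le_of_le h.c₄' (hdiv1 m1))
      (norm_mul_le_of_le h.c₄ (hdiv 2 hv)))).trans ?_
  have h1 : M * 1 ≤ M * M := by gcongr
  have h2 : M * ‖v‖ ^ 2 ≤ M * M * ‖v‖ ^ 2 := by
    gcongr
    linarith
  have h3 : M * ‖v‖ ≤ M * (1 + ‖v‖ ^ 2) := by
    gcongr
    nlinarith [sq_nonneg (‖v‖ - 1)]
  have h4 : 0 ≤ M * M * ‖v‖ ^ 2 := by positivity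
  nlinarith

end CoeffJet

/-! ### The modified energy along a solution -/

/-- The coefficient values at `z`. -/
noncomputable def coeffJet (a b : ℂ) (β γ : ℂ → ℂ) (z : ℂ) : CoeffJet where
  a := a
  A := a * z + b
  β := β z
  β₁ := deriv β z
  β₂ := deriv (deriv β) z
  β₃ := deriv (deriv (deriv β)) z
  γ := γ z
  γ₁ := deriv γ z
  γ₂ := deriv (deriv γ) z

theorem ContinuousAt.exists_norm_le {X E : Type*} [TopologicalSpace X] [NormedAddCommGroup E]
    {g : X → E} {x : X} (hg : ContinuousAt g x) : ∃ M, 0 ≤ M ∧ ∀ᶠ x' in 𝓝 x, ‖g x'‖ ≤ M :=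
  ⟨‖g x‖ + 1, by positivity, hg.norm.eventually_le_const (lt_add_one _)⟩

section Jet

variable {a b : ℂ} {β γ : ℂ → ℂ} {z : ℂ}

theorem exists_boundedBy (hβ : AnalyticAt ℂ β z) (hγ : AnalyticAt ℂ γ z) :
    ∃ M, ∀ᶠ z' in 𝓝 z, (coeffJet a b β γ z').BoundedBy M := by
  have b0 := hβ.continuousAt
  have b1 := hβ.deriv.continuousAt
  have b2 := hβ.deriv.deriv.continuousAt
  have b3 := hβ.deriv.deriv.deriv.continuousAt
  have g0 := hγ.continuousAt
  have g1 := hγ.deriv.continuousAt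
  have g2 := hγ.deriv.deriv.continuousAt
  obtain ⟨M1, h1, e1⟩ := (continuousAt_const (x := z) (y := a)).exists_norm_le
  obtain ⟨M2, h2, e2⟩ := (show ContinuousAt (fun z => a * z + b) z by fun_prop).exists_norm_le
  obtain ⟨M3, h3, e3⟩ := b0.exists_norm_le
  obtain ⟨M4, h4, e4⟩ := b1.exists_norm_le
  obtain ⟨M5, h5, e5⟩ := g0.exists_norm_le
  obtain ⟨M6, h6, e6⟩ := g1.exists_norm_le
  obtain ⟨M7, h7, e7⟩ := (show ContinuousAt (fun z => (coeffJet a b β γ z).c₁) z by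
    simp only [CoeffJet.c₁, coeffJet]; fun_prop).exists_norm_le
  obtain ⟨M8, h8, e8⟩ := (show ContinuousAt (fun z => (coeffJet a b β γ z).c₂) z by
    simp only [CoeffJet.c₂, coeffJet]; fun_prop).exists_norm_le
  obtain ⟨M9, h9, e9⟩ := (show ContinuousAt (fun z => (coeffJet a b β γ z).c₃) z by
    simp only [CoeffJet.c₃, CoeffJet.c₁, coeffJet]; fun_prop).exists_norm_le
  obtain ⟨M10, h10, e10⟩ := (show ContinuousAt (fun z => (coeffJet a b β γ z).c₄) z by
    simp only [CoeffJet.c₄, coeffJet]; fun_prop).exists_norm_le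
  obtain ⟨M11, h11, e11⟩ := (show ContinuousAt (fun z => (coeffJet a b β γ z).c₃') z by
    simp only [CoeffJet.c₃', CoeffJet.c₁, coeffJet]; fun_prop).exists_norm_le
  obtain ⟨M12, h12, e12⟩ := (show ContinuousAt (fun z => (coeffJet a b β γ z).c₄') z by
    simp only [CoeffJet.c₄', coeffJet]; fun_prop).exists_norm_le
  refine ⟨1 + M1 + M2 + M3 + M4 + M5 + M6 + M7 + M8 + M9 + M10 + M11 + M12, ?_⟩
  filter_upwards [e1, e2, e3, e4, e5, e6, e7, e8, e9, e10, e11, e12] with z' e1 e2 e3 e4 e5 e6 e7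
    e8 e9 e10 e11 e12
  exact
    { one_le := by linarith
      a := e1.trans (by linarith)
      A := e2.trans (by linarith)
      β := e3.trans (by linarith)
      β₁ := e4.trans (by linarith)
      γ := e5.trans (by linarith)
      γ₁ := e6.trans (by linarith)
      c₁ := e7.trans (by linarith)
      c₂ := e8.trans (by linarith)
      c₃ := e9.trans (by linarith)
      c₄ := e10.trans (by linarith)
      c₃' := e11.trans (by linarith)
      c₄' := e12.trans (by linarith) }

theorem hasDerivAt_energy (hβ : AnalyticAt ℂ β z) (hγ : AnalyticAt ℂ γ z) {y v : ℂ → ℂ}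
    (hy : HasDerivAt y (v z) z) (hv : HasDerivAt v ((coeffJet a b β γ z).rhs (y z)) z) :
    HasDerivAt (fun z => (coeffJet a b β γ z).energy (y z) (v z))
      ((coeffJet a b β γ z).energyDeriv (y z)) z := by
  have hβ' := hβ.differentiableAt.hasDerivAt
  have hγ' := hγ.differentiableAt.hasDerivAt
  have hA : HasDerivAt (fun z => a * z + b) a z := by
    simpa using ((hasDerivAt_id z).const_mul a).add_const b
  have h := (((((hv.pow 2).div_const 2).sub ((hy.pow 5).div_const 5)).sub
    ((hA.mul (hy.pow 3)).div_const 3)).sub ((hβ'.mul (hy.pow 2)).div_const 2)).sub (hγ'.mul hy)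
  refine h.congr_deriv ?_
  simp only [CoeffJet.energyDeriv, CoeffJet.rhs, coeffJet, Pi.pow_apply]
  push_cast
  ring

theorem hasDerivAt_correction (hβ : AnalyticAt ℂ β z) (hγ : AnalyticAt ℂ γ z) {y v : ℂ → ℂ}
    (hy : HasDerivAt y (v z) z) (hv : HasDerivAt v ((coeffJet a b β γ z).rhs (y z)) z)
    (hy0 : y z ≠ 0) :
    HasDerivAt (fun z => (coeffJet a b β γ z).correction (y z) (v z))
      ((coeffJet a b β γ z).correctionDeriv (y z) (v z)) z := by
  have hβ₁ := hβ.deriv.differentiableAt.hasDerivAt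
  have hβ₂ := hβ.deriv.deriv.differentiableAt.hasDerivAt
  have hγ₁ := hγ.deriv.differentiableAt.hasDerivAt
  have hA : HasDerivAt (fun z => a * z + b) a z := by
    simpa using ((hasDerivAt_id z).const_mul a).add_const b
  have hc₃ : HasDerivAt (fun z => (coeffJet a b β γ z).c₃) (coeffJet a b β γ z).c₃' z :=
    (((hA.const_mul (5 / 9 * a)).div_const 3).sub hγ₁).const_mul 5
  have h := ((((hv.div hy hy0).const_mul (5 / 9 * a)).add ((hβ₁.const_mul (5 / 2)).mul
    (hv.div (hy.pow 2) (pow_ne_zero 2 hy0)))).add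
    (hc₃.mul (hv.div (hy.pow 3) (pow_ne_zero 3 hy0)))).add
    ((hβ₂.const_mul (5 / 2)).mul ((hasDerivAt_const z (1 : ℂ)).div hy hy0))
  refine h.congr_deriv ?_
  simp only [CoeffJet.correctionDeriv, CoeffJet.c₁, CoeffJet.c₂, CoeffJet.c₄, CoeffJet.c₄',
    Pi.pow_apply, Pi.div_apply]
  generalize (coeffJet a b β γ z).rhs (y z) = R
  generalize (coeffJet a b β γ z).c₃ = C
  generalize (coeffJet a b β γ z).c₃' = C'
  simp only [coeffJet]
  field_simp
  push_cast
  ring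

end Jet

/-- A smooth cutoff that vanishes for `|y| ≤ 1` and equals `1` for `|y|² ≥ 2`. -/
noncomputable def cutoff (y : ℂ) : ℝ := Real.smoothTransition (‖y‖ ^ 2 - 1)

/-- The modified energy: the correction is switched on only away from the zeros of `y`. -/
noncomputable def CoeffJet.modEnergy (J : CoeffJet) (y v : ℂ) : ℂ :=
  J.energy y v + cutoff y * J.correction y v

theorem norm_cutoff_le (y : ℂ) : ‖(cutoff y : ℂ)‖ ≤ 1 := by
  rw [Complex.norm_real, cutoff, Real.norm_of_nonneg (Real.smoothTransition.nonneg _)]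
  exact Real.smoothTransition.le_one _

theorem cutoff_eq_zero {y : ℂ} (hy : ‖y‖ < 1) : cutoff y = 0 :=
  Real.smoothTransition.zero_of_nonpos (by nlinarith [norm_nonneg y])

theorem cutoff_eq_one {y : ℂ} (hy : 2 < ‖y‖) : cutoff y = 1 :=
  Real.smoothTransition.one_of_one_le (by nlinarith [norm_nonneg y])

theorem exists_abs_deriv_smoothTransition_le :
    ∃ X : ℝ, 0 ≤ X ∧ ∀ x ∈ Icc (0 : ℝ) 3, |deriv Real.smoothTransition x| ≤ X := by
  have hc : Continuous (deriv Real.smoothTransition) :=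
    (Real.smoothTransition.contDiff (n := 1)).continuous_deriv le_rfl
  obtain ⟨X, hX⟩ := isCompact_Icc.exists_bound_of_continuousOn (s := Icc (0 : ℝ) 3)
    hc.continuousOn
  exact ⟨X, (norm_nonneg _).trans (hX 0 ⟨le_rfl, by norm_num⟩), hX⟩

/-- Along a solution, composed with any curve in the `z`-plane, the modified energy `G` satisfies
`|G'| ≤ C (1 + |G|)`. Where the cutoff varies, `y` is bounded and all terms are at most
quadratic in `v`, hence at most linear in `G`. -/
theorem exists_modEnergy_deriv_bound {M : ℝ} (hM1 : 1 ≤ M) : ∃ C, 0 ≤ C ∧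
    ∀ {a b : ℂ} {β γ y v : ℂ → ℂ} {ζ : ℝ → ℂ} {δ : ℂ} {r : ℝ},
      AnalyticAt ℂ β (ζ r) → AnalyticAt ℂ γ (ζ r) → (coeffJet a b β γ (ζ r)).BoundedBy M →
      HasDerivAt y (v (ζ r)) (ζ r) →
      HasDerivAt v ((coeffJet a b β γ (ζ r)).rhs (y (ζ r))) (ζ r) →
      HasDerivAt ζ δ r →
      ∃ D, HasDerivAt
          (fun r => (coeffJet a b β γ (ζ r)).modEnergy (y (ζ r)) (v (ζ r))) D r ∧
        ‖D‖ ≤ C * (1 + ‖(coeffJet a b β γ (ζ r)).modEnergy (y (ζ r)) (v (ζ r))‖) * ‖δ‖ := by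
  obtain ⟨X, hX0, hX⟩ := exists_abs_deriv_smoothTransition_le
  have hM : 0 ≤ M := zero_le_one.trans hM1
  set C₀ := 4 * (1 + 4 * M + 9 * M ^ 2) with hC₀
  have hC₀0 : 0 ≤ C₀ := by positivity
  set C₁ := (15 * M ^ 2) * ((2 + 4 * M) * (3 + C₀)) with hC₁
  have hC₁0 : 0 ≤ C₁ := by positivity
  set P := 7 * M + 73 * M ^ 2 + 16 * X * M with hP
  have hP0 : 0 ≤ P := by positivity
  refine ⟨C₁ + P * (1 + 32 * C₀), by positivity, ?_⟩
  intro a b β γ y v ζ δ r hβ hγ hJ hy hv hζ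
  set J := coeffJet a b β γ (ζ r) with hJdef
  set G := J.modEnergy (y (ζ r)) (v (ζ r)) with hG
  have hE : HasDerivAt (fun r => (coeffJet a b β γ (ζ r)).energy (y (ζ r)) (v (ζ r)))
      (δ * J.energyDeriv (y (ζ r))) r := by
    simpa [Function.comp_def] using (hasDerivAt_energy hβ hγ hy hv).scomp r hζ
  have hcont : ContinuousAt (fun r => ‖y (ζ r)‖) r :=
    (hy.continuousAt.comp (x := r) hζ.continuousAt).norm
  -- For `|y| < 1` the modified energy is locally the energy itself.
  rcases lt_or_ge ‖y (ζ r)‖ 1 with h1 | h1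
  · refine ⟨δ * J.energyDeriv (y (ζ r)), hE.congr_of_eventuallyEq ?_, ?_⟩
    · filter_upwards [hcont.eventually_lt_const h1] with s hs
      simp [CoeffJet.modEnergy, cutoff_eq_zero hs]
    · rw [norm_mul, mul_comm]
      gcongr
      calc ‖J.energyDeriv (y (ζ r))‖ ≤ 7 * M := CoeffJet.norm_energyDeriv_le hJ (by linarith)
        _ ≤ P := by
          have : 0 ≤ 73 * M ^ 2 + 16 * X * M := by positivity
          linarith
        _ ≤ (C₁ + P * (1 + 32 * C₀)) * 1 := by
          have : 0 ≤ P * (32 * C₀) := by positivity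
          linarith
        _ ≤ _ := by
          gcongr
          linarith [norm_nonneg G]
  have hy0 : y (ζ r) ≠ 0 := norm_pos_iff.1 (by linarith)
  have hK : HasDerivAt (fun r => (coeffJet a b β γ (ζ r)).correction (y (ζ r)) (v (ζ r)))
      (δ * J.correctionDeriv (y (ζ r)) (v (ζ r))) r := by
    simpa [Function.comp_def] using (hasDerivAt_correction hβ hγ hy hv hy0).scomp r hζ
  -- For `|y| > 2` it is locally the fully corrected energy; in between the cutoff may vary.
  rcases lt_or_ge 2 ‖y (ζ r)‖ with h2 | h2
  · refine ⟨_, (hE.add hK).congr_of_eventuallyEq ?_, ?_⟩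
    · filter_upwards [hcont.eventually_const_lt h2] with s hs
      simp [CoeffJet.modEnergy, cutoff_eq_one hs]
    · rw [← mul_add, norm_mul, mul_comm, CoeffJet.energyDeriv_add_correctionDeriv _ hy0]
      gcongr
      have hG' : G = J.energy (y (ζ r)) (v (ζ r)) + J.correction (y (ζ r)) (v (ζ r)) := by
        simp [hG, CoeffJet.modEnergy, cutoff_eq_one h2]
      rw [hG']
      refine (CoeffJet.norm_remainder_le hJ h1 _).trans ?_
      gcongr
      have : 0 ≤ P * (1 + 32 * C₀) := by positivity
      linarith
  · have hyζ : HasDerivAt (fun r => y (ζ r)) (δ * v (ζ r)) r := by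
      simpa [Function.comp_def] using hy.scomp r hζ
    set χ' : ℝ := deriv Real.smoothTransition (‖y (ζ r)‖ ^ 2 - 1) *
      (2 * inner ℝ (y (ζ r)) (δ * v (ζ r))) with hχ'
    have hχ : HasDerivAt (fun r => cutoff (y (ζ r))) χ' r := by
      have hs : HasDerivAt Real.smoothTransition
          (deriv Real.smoothTransition (‖y (ζ r)‖ ^ 2 - 1)) (‖y (ζ r)‖ ^ 2 - 1) :=
        ((Real.smoothTransition.contDiff (n := 1)).differentiable one_ne_zero _).hasDerivAt
      exact hs.comp r (hyζ.norm_sq.sub_const 1)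
    have hχC : HasDerivAt (fun r => (cutoff (y (ζ r)) : ℂ)) (χ' : ℂ) r := hχ.ofReal_comp
    refine ⟨_, hE.add (hχC.mul hK), ?_⟩
    set V := ‖v (ζ r)‖ with hV
    have hV0 : 0 ≤ V := norm_nonneg _
    have hχn : ‖(χ' : ℂ)‖ ≤ X * (2 * (2 * (‖δ‖ * V))) := by
      rw [Complex.norm_real, hχ', norm_mul, norm_mul, Real.norm_ofNat]
      gcongr
      · exact hX _ ⟨by nlinarith, by nlinarith⟩
      · refine (abs_real_inner_le_norm _ _).trans ?_
        rw [norm_mul]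
        gcongr
    have hn := norm_add_le_of_le
      (norm_mul_le_of_le (le_refl ‖δ‖) (CoeffJet.norm_energyDeriv_le hJ h2))
      (norm_add_le_of_le (norm_mul_le_of_le hχn (CoeffJet.norm_correction_le hJ h1 (v (ζ r))))
      (norm_mul_le_of_le (norm_cutoff_le (y (ζ r))) (norm_mul_le_of_le (le_refl ‖δ‖)
        (CoeffJet.norm_correctionDeriv_le hJ h1 h2 (v (ζ r))))))
    refine hn.trans ?_
    have hVG : V ^ 2 ≤ C₀ * (‖G‖ + 32) := by
      have := CoeffJet.norm_sq_le (κ := cutoff (y (ζ r))) (v := v (ζ r)) hJ one_le_two h2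
        (norm_cutoff_le _) (fun h => absurd h (not_lt.2 h1))
      norm_num at this
      exact this
    have hPV : P * (1 + V ^ 2) ≤ (C₁ + P * (1 + 32 * C₀)) * (1 + ‖G‖) := by
      have h3 : P * V ^ 2 ≤ P * (C₀ * (‖G‖ + 32)) := by gcongr
      have h4 : 0 ≤ C₁ * (1 + ‖G‖) := by positivity
      have h5 : 0 ≤ P * ‖G‖ := by positivity
      have h6 : 0 ≤ P * C₀ * ‖G‖ := by positivity
      nlinarith
    refine le_trans ?_ (mul_le_mul_of_nonneg_right hPV (norm_nonneg δ))
    have h7 : V * (3 * M * V + M) ≤ 4 * M * (1 + V ^ 2) := by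
      nlinarith [mul_nonneg hM (sq_nonneg (V - 1)), mul_nonneg hM (sq_nonneg V)]
    have h8 : X * (V * (3 * M * V + M)) ≤ X * (4 * M * (1 + V ^ 2)) := by gcongr
    have h9 : 0 ≤ M * V ^ 2 := by positivity
    calc _ = (7 * M + 4 * (X * (V * (3 * M * V + M))) + 73 * M ^ 2 * (1 + V ^ 2)) * ‖δ‖ := by
          rw [← hV]; ring
      _ ≤ P * (1 + V ^ 2) * ‖δ‖ := by
          gcongr
          rw [hP]
          linarith

/-! ### Boundedness of the modified energy and blow-up at a singularity -/

/-- Local uniqueness for a reparametrized autonomous system `φ' = k • Φ(φ)`. -/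
theorem eventuallyEq_of_hasDerivAt_smul {E : Type*} [NormedAddCommGroup E] [NormedSpace ℂ E]
    [CompleteSpace E]
    {Φ : E → E} {φ ψ : ℂ → E} {k : ℂ → ℂ} {z₀ : ℂ} (hΦ : AnalyticAt ℂ Φ (φ z₀))
    (hk : ContinuousAt k z₀) (hφ : ∀ᶠ z in 𝓝 z₀, HasDerivAt φ (k z • Φ (φ z)) z)
    (hψ : ∀ᶠ z in 𝓝 z₀, HasDerivAt ψ (k z • Φ (ψ z)) z) (h₀ : φ z₀ = ψ z₀) :
    φ =ᶠ[𝓝 z₀] ψ := by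
  obtain ⟨L, S, hS, hL⟩ := (hΦ.contDiffAt (n := 1)).exists_lipschitzOnWith
  have hφS : ∀ᶠ z in 𝓝 z₀, φ z ∈ S := hφ.self_of_nhds.continuousAt.eventually_mem hS
  have hψS : ∀ᶠ z in 𝓝 z₀, ψ z ∈ S :=
    hψ.self_of_nhds.continuousAt.eventually_mem (by rwa [← h₀])
  obtain ⟨K, hK, hkK⟩ := hk.exists_norm_le
  refine eventuallyEq_of_hasDerivAt_of_lipschitz (K := K * L) hφ hψ ?_ h₀
  filter_upwards [hφS, hψS, hkK] with z h1 h2 h3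
  rw [← smul_sub, norm_smul, mul_assoc]
  gcongr
  exact hL.norm_sub_le h1 h2

/-- From the parameter `t₀` on, `f` is an analytic continuation along `p` of a solution, and the
coefficients are analytic along `p`. -/
structure IsSolutionFrom (a b : ℂ) (β γ : ℂ → ℂ) (t₀ : ℝ) (p : ℝ → ℂ) (f : ℝ → ℂ → ℂ) : Prop where
  continuation : IsContinuationFrom t₀ p f
  analyticAt_left : ∀ t ∈ Ico t₀ 1, AnalyticAt ℂ β (p t)
  analyticAt_right : ∀ t ∈ Ico t₀ 1, AnalyticAt ℂ γ (p t)
  solves : ∀ t ∈ Ico t₀ 1, ∀ᶠ z in 𝓝 (p t),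
    deriv (deriv (f t)) z = (coeffJet a b β γ z).rhs (f t z)

theorem AnalyticAt.coeffJet_rhs {a b : ℂ} {β γ f : ℂ → ℂ} {z : ℂ} (hβ : AnalyticAt ℂ β z)
    (hγ : AnalyticAt ℂ γ z) (hf : AnalyticAt ℂ f z) :
    AnalyticAt ℂ (fun z => (coeffJet a b β γ z).rhs (f z)) z := by
  simp only [CoeffJet.rhs, coeffJet]
  fun_prop

namespace IsSolutionFrom

variable {a b : ℂ} {β γ : ℂ → ℂ} {t₀ : ℝ} {p : ℝ → ℂ} {f : ℝ → ℂ → ℂ}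

theorem mono (h : IsSolutionFrom a b β γ t₀ p f) {t₁ : ℝ} (ht : t₀ ≤ t₁) :
    IsSolutionFrom a b β γ t₁ p f where
  continuation := h.continuation.mono ht
  analyticAt_left t hs := h.analyticAt_left t (Ico_subset_Ico_left ht hs)
  analyticAt_right t hs := h.analyticAt_right t (Ico_subset_Ico_left ht hs)
  solves t hs := h.solves t (Ico_subset_Ico_left ht hs)

/-- The continuation of a solution is a solution. -/
theorem of_initial (hp : ContinuousOn p (Ico t₀ 1)) (hf : IsContinuationFrom t₀ p f)
    (hβ : ∀ t ∈ Ico t₀ 1, AnalyticAt ℂ β (p t)) (hγ : ∀ t ∈ Ico t₀ 1, AnalyticAt ℂ γ (p t))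
    (ht₀ : t₀ < 1) (h₀ : ∀ᶠ z in 𝓝 (p t₀),
      deriv (deriv (f t₀)) z = (coeffJet a b β γ z).rhs (f t₀ z)) :
    IsSolutionFrom a b β γ t₀ p f where
  continuation := hf
  analyticAt_left := hβ
  analyticAt_right := hγ
  solves t ht := by
    have hr : IsContinuationFrom t₀ p (fun t z => (coeffJet a b β γ z).rhs (f t z)) :=
      fun t ht => ⟨(hβ t ht).coeffJet_rhs (hγ t ht) (hf t ht).1,
        (hf t ht).2.mono fun s hs => hs.mono fun z hz => by simp only [hz]⟩
    exact hf.deriv.deriv.eventuallyEq hr hp ⟨le_rfl, ht₀⟩ h₀ ht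

theorem eventually_hasDerivAt (h : IsSolutionFrom a b β γ t₀ p f) {t : ℝ} (ht : t ∈ Ico t₀ 1) :
    ∀ᶠ z in 𝓝 (p t), HasDerivAt (f t) (deriv (f t) z) z ∧
      HasDerivAt (deriv (f t)) ((coeffJet a b β γ z).rhs (f t z)) z := by
  filter_upwards [(h.continuation t ht).1.eventually_analyticAt, h.solves t ht] with z h1 h2
  exact ⟨h1.differentiableAt.hasDerivAt, h2 ▸ h1.deriv.differentiableAt.hasDerivAt⟩

end IsSolutionFrom

theorem hasDerivAt_log_one_add_norm_sq {G : ℝ → ℂ} {D : ℂ} {r C d : ℝ} (hC : 0 ≤ C) (hd : 0 ≤ d)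
    (hG : HasDerivAt G D r) (hD : ‖D‖ ≤ C * (1 + ‖G r‖) * d) :
    ∃ D', HasDerivAt (fun r => Real.log (1 + ‖G r‖ ^ 2)) D' r ∧ ‖D'‖ ≤ 4 * C * d := by
  have hpos : 0 < 1 + ‖G r‖ ^ 2 := by positivity
  refine ⟨_, (hG.norm_sq.const_add 1).log hpos.ne', ?_⟩
  rw [norm_div, Real.norm_of_nonneg hpos.le, div_le_iff₀ hpos, norm_mul, Real.norm_ofNat]
  have h1 : ‖inner ℝ (G r) D‖ ≤ ‖G r‖ * (C * (1 + ‖G r‖) * d) :=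
    (abs_real_inner_le_norm _ _).trans (by gcongr)
  have h2 : ‖G r‖ * (1 + ‖G r‖) ≤ 2 * (1 + ‖G r‖ ^ 2) := by
    nlinarith [sq_nonneg (‖G r‖ - 1), norm_nonneg (G r)]
  have h3 : C * d * (‖G r‖ * (1 + ‖G r‖)) ≤ C * d * (2 * (1 + ‖G r‖ ^ 2)) := by gcongr
  nlinarith

open Metric in
/-- The modified energy stays bounded along a path of finite length, by integrating
`|G'| ≤ C (1 + |G|)` in the form of a Lipschitz bound for `log (1 + |G| ^ 2)`. -/
theorem IsSolutionFrom.exists_modEnergy_le {a b : ℂ} {β γ : ℂ → ℂ} {t₀ : ℝ} {p : ℝ → ℂ}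
    {f : ℝ → ℂ → ℂ} (h : IsSolutionFrom a b β γ t₀ p f) (hp : ContinuousOn p (Ico t₀ 1))
    (hbv : BoundedVariationOn p (Ico t₀ 1)) {M : ℝ}
    (hM : ∀ t ∈ Ico t₀ 1, ∀ᶠ z in 𝓝 (p t), (coeffJet a b β γ z).BoundedBy M) :
    ∃ B, ∀ t ∈ Ico t₀ 1,
      ‖(coeffJet a b β γ (p t)).modEnergy (f t (p t)) (deriv (f t) (p t))‖ ≤ B := by
  rcases lt_or_ge t₀ 1 with ht₀ | ht₀
  swap
  · exact ⟨0, fun t ht => absurd (ht.1.trans_lt ht.2) (not_lt.2 ht₀)⟩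
  have hM1 : 1 ≤ M := (hM t₀ ⟨le_rfl, ht₀⟩).self_of_nhds.one_le
  obtain ⟨C, hC, hder⟩ := exists_modEnergy_deriv_bound hM1
  set G : ℝ → ℂ → ℂ := fun t z => (coeffJet a b β γ z).modEnergy (f t z) (deriv (f t) z) with hG
  set L : ℝ → ℝ := fun t => Real.log (1 + ‖G t (p t)‖ ^ 2) with hL
  -- Near each parameter, the logarithm of the modified energy is Lipschitz as a function of `p`.
  have hloc : ∀ t ∈ Ico t₀ 1, ∃ O ∈ 𝓝[Ico t₀ 1] t, ∀ s ∈ O, ∀ s' ∈ O,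
      |L s - L s'| ≤ 4 * C * ‖p s - p s'‖ := by
    intro t ht
    obtain ⟨ε, hε, hb⟩ := Metric.eventually_nhds_iff_ball.1
      ((h.analyticAt_left t ht).eventually_analyticAt.and
        ((h.analyticAt_right t ht).eventually_analyticAt.and
          ((hM t ht).and (h.eventually_hasDerivAt ht))))
    have hlip : ∀ z₁ ∈ ball (p t) ε, ∀ z₂ ∈ ball (p t) ε,
        ‖Real.log (1 + ‖G t z₁‖ ^ 2) - Real.log (1 + ‖G t z₂‖ ^ 2)‖ ≤ 4 * C * ‖z₁ - z₂‖ := by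
      intro z₁ hz₁ z₂ hz₂
      set ζ : ℝ → ℂ := fun r => z₂ + r * (z₁ - z₂) with hζ
      have hζd : ∀ r, HasDerivAt ζ (z₁ - z₂) r := fun r => by
        simpa [hζ] using
          ((Complex.ofRealCLM.hasDerivAt (x := r)).mul_const (z₁ - z₂)).const_add z₂
      have hζm : ∀ r ∈ Icc (0 : ℝ) 1, ζ r ∈ ball (p t) ε := fun r hr => by
        have := (convex_ball (p t) ε).add_smul_sub_mem hz₂ hz₁ hr
        simpa [hζ] using this
      have hD : ∀ r ∈ Icc (0 : ℝ) 1, ∃ D',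
          HasDerivAt (fun r => Real.log (1 + ‖G t (ζ r)‖ ^ 2)) D' r ∧
            ‖D'‖ ≤ 4 * C * ‖z₁ - z₂‖ := by
        intro r hr
        obtain ⟨h1, h2, h3, h4, h5⟩ := hb _ (hζm r hr)
        obtain ⟨D, hD, hDn⟩ := hder h1 h2 h3 h4 h5 (hζd r)
        exact hasDerivAt_log_one_add_norm_sq hC (norm_nonneg _) hD hDn
      choose! D' hD' hDn' using hD
      have := Convex.norm_image_sub_le_of_norm_hasDerivWithin_le
        (fun r hr => (hD' r hr).hasDerivWithinAt) hDn' (convex_Icc (0 : ℝ) 1)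
        (left_mem_Icc.2 zero_le_one) (right_mem_Icc.2 zero_le_one)
      simpa [hζ] using this
    refine ⟨{s | p s ∈ ball (p t) ε ∧ f s =ᶠ[𝓝 (p s)] f t}, ?_, ?_⟩
    · exact inter_mem ((hp t ht) (ball_mem_nhds _ hε)) (h.continuation t ht).2
    · rintro s ⟨hs, hfs⟩ s' ⟨hs', hfs'⟩
      have e : ∀ {s}, f s =ᶠ[𝓝 (p s)] f t → G s (p s) = G t (p s) := fun hs => by
        simp only [hG, hs.eq_of_nhds, hs.deriv.eq_of_nhds]
      simp only [hL, e hfs, e hfs']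
      exact hlip _ hs _ hs'
  refine ⟨Real.exp (L t₀ + 4 * C * (eVariationOn p (Ico t₀ 1)).toReal), fun t ht => ?_⟩
  have hsub : Icc t₀ t ⊆ Ico t₀ 1 := Icc_subset_Ico_right ht.2
  have hvar := abs_sub_le_variation_of_locally (g := L) (C := 4 * C) (by positivity) ht.1 hsub hbv fun s hs => by
    obtain ⟨O, hO, hOb⟩ := hloc s (hsub hs)
    exact ⟨O, nhdsWithin_mono _ hsub hO, hOb⟩
  have hLt : L t ≤ L t₀ + 4 * C * (eVariationOn p (Ico t₀ 1)).toReal := by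
    linarith [le_abs_self (L t - L t₀)]
  have hpos : 0 < 1 + ‖G t (p t)‖ ^ 2 := by positivity
  calc ‖G t (p t)‖ ≤ 1 + ‖G t (p t)‖ ^ 2 := by
        nlinarith [sq_nonneg (‖G t (p t)‖ - 1), norm_nonneg (G t (p t))]
    _ = Real.exp (L t) := (Real.exp_log hpos).symm
    _ ≤ _ := Real.exp_le_exp.2 hLt

theorem eventually_dist_right_end_lt {p : ℝ → ℂ} {t₀ : ℝ} (ht₀ : t₀ < 1)
    (hp : ContinuousOn p (Icc t₀ 1)) {ε : ℝ} (hε : 0 < ε) :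
    ∀ᶠ t in 𝓝[<] (1 : ℝ), dist (p t) (p 1) < ε := by
  have h1 : ContinuousWithinAt p (Iio 1) 1 :=
    (hp 1 (right_mem_Icc.2 ht₀.le)).mono_of_mem_nhdsWithin
      (mem_of_superset (Ioo_mem_nhdsLT ht₀) Ioo_subset_Icc_self)
  exact h1 (Metric.ball_mem_nhds _ hε)

theorem analyticAt_snd_fst (x : ℂ × ℂ × ℂ) : AnalyticAt ℂ (fun x : ℂ × ℂ × ℂ => x.2.1) x :=
  ((ContinuousLinearMap.fst ℂ ℂ ℂ).comp (ContinuousLinearMap.snd ℂ ℂ (ℂ × ℂ))).analyticAt x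

theorem analyticAt_snd_snd (x : ℂ × ℂ × ℂ) : AnalyticAt ℂ (fun x : ℂ × ℂ × ℂ => x.2.2) x :=
  ((ContinuousLinearMap.snd ℂ ℂ ℂ).comp (ContinuousLinearMap.snd ℂ ℂ (ℂ × ℂ))).analyticAt x

open Metric in
/-- Either the continuation of a solution with bounded modified energy tends to infinity, or it
extends analytically to the endpoint: at parameters where it stays bounded, so does its
derivative, and the solution exists in a disc of a radius that does not shrink. -/
theorem IsSolutionFrom.tendsto_norm_atTop {a b : ℂ} {β γ : ℂ → ℂ} {t₀ : ℝ} {p : ℝ → ℂ}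
    {f : ℝ → ℂ → ℂ} (h : IsSolutionFrom a b β γ t₀ p f) (ht₀ : t₀ < 1)
    (hp : ContinuousOn p (Icc t₀ 1))
    (hβ : AnalyticAt ℂ β (p 1)) (hγ : AnalyticAt ℂ γ (p 1)) {M B : ℝ}
    (hM : ∀ t ∈ Ico t₀ 1, (coeffJet a b β γ (p t)).BoundedBy M)
    (hB : ∀ t ∈ Ico t₀ 1,
      ‖(coeffJet a b β γ (p t)).modEnergy (f t (p t)) (deriv (f t) (p t))‖ ≤ B)
    (hsing : EndsInSingularity p f) :
    Tendsto (fun t => ‖f t (p t)‖) (𝓝[<] 1) atTop := by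
  rw [Filter.tendsto_atTop]
  by_contra hcon
  obtain ⟨R, hR⟩ := not_forall.1 hcon
  have hIco : ∀ᶠ t in 𝓝[<] (1 : ℝ), t ∈ Ico t₀ 1 := Ico_mem_nhdsLT ht₀
  set Y := max 1 R
  set V := 4 * (1 + 4 * M + 9 * M ^ 2) * (B + Y ^ 5)
  have hV : ∀ t ∈ Ico t₀ 1, ‖f t (p t)‖ ≤ R → ‖deriv (f t) (p t)‖ ≤ 1 + V := by
    intro t ht hy
    have hM0 := zero_le_one.trans (hM t ht).one_le
    have h1 := CoeffJet.norm_sq_le (κ := cutoff (f t (p t))) (v := deriv (f t) (p t)) (hM t ht) (le_max_left 1 R)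
      (hy.trans (le_max_right 1 R)) (norm_cutoff_le _)
      (fun hlt => by simp [cutoff_eq_zero hlt])
    have h2 : ‖deriv (f t) (p t)‖ ^ 2 ≤ V := by
      refine h1.trans ?_
      have := hB t ht
      unfold V
      gcongr
      exact this
    nlinarith [sq_nonneg (‖deriv (f t) (p t)‖ - 1), norm_nonneg (deriv (f t) (p t))]
  have hfreq : ∃ᶠ t in 𝓝[<] (1 : ℝ), (f t (p t), deriv (f t) (p t)) ∈
      closedBall (0 : ℂ) R ×ˢ closedBall (0 : ℂ) (1 + V) := by
    rw [not_eventually] at hR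
    refine (hR.and_eventually hIco).mono fun t ⟨h1, h2⟩ => ?_
    have h3 := (not_le.1 h1).le
    exact ⟨by simpa using h3, by simpa using hV t h2 h3⟩
  obtain ⟨⟨y₁, v₁⟩, -, hcl⟩ := ((isCompact_closedBall (0 : ℂ) R).prod
    (isCompact_closedBall (0 : ℂ) (1 + V))).exists_mapClusterPt_of_frequently hfreq
  -- The equation as an autonomous system for `(z, y, y')`.
  set Φ : ℂ × ℂ × ℂ → ℂ × ℂ × ℂ := fun x => (1, x.2.2, (coeffJet a b β γ x.1).rhs x.2.1) with hΦ
  have hΦan : ∀ x : ℂ × ℂ × ℂ, AnalyticAt ℂ β x.1 → AnalyticAt ℂ γ x.1 → AnalyticAt ℂ Φ x := by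
    intro x hβ hγ
    have hβ' : AnalyticAt ℂ (fun x : ℂ × ℂ × ℂ => β x.1) x := hβ.comp_of_eq analyticAt_fst rfl
    have hγ' : AnalyticAt ℂ (fun x : ℂ × ℂ × ℂ => γ x.1) x := hγ.comp_of_eq analyticAt_fst rfl
    have h₁ := analyticAt_snd_fst x
    have h₂ := analyticAt_snd_snd x
    have h₀ : AnalyticAt ℂ (fun x : ℂ × ℂ × ℂ => x.1) x := analyticAt_fst
    refine analyticAt_const.prod (h₂.prod ?_)
    simp only [CoeffJet.rhs, coeffJet]
    fun_prop
  obtain ⟨ρ, hρ, N, hN, hsol⟩ := exists_uniform_holomorphic_solution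
    (hΦan (p 1, y₁, v₁) hβ hγ) univ_mem
  rw [nhds_prod_eq, mem_prod_iff] at hN
  obtain ⟨N₁, hN₁, N₂, hN₂, hNsub⟩ := hN
  obtain ⟨η, hη, hηN⟩ := Metric.mem_nhds_iff.1 hN₁
  have hp1 := eventually_dist_right_end_lt ht₀ hp (lt_min hη (half_pos hρ))
  obtain ⟨t₁, ht₁, ht₁b⟩ := (mem_nhdsLT_iff_exists_Ico_subset).1 (hp1.and hIco)
  obtain ⟨t, ht2, ht⟩ := ((hcl.frequently hN₂).and_eventually
    (Ico_mem_nhdsLT (show t₁ < 1 from ht₁))).exists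
  have htI : t ∈ Ico t₀ 1 := (ht₁b ht).2
  obtain ⟨φ, hφ0, hφ⟩ := hsol (p t, f t (p t), deriv (f t) (p t))
    (hNsub ⟨hηN ((ht₁b ht).1.trans_le (min_le_left _ _)), ht2⟩)
  have hclose : ∀ s ∈ Ico t 1, p s ∈ ball (p t) ρ := by
    intro s hs
    have h1 := (ht₁b ⟨ht.1.trans hs.1, hs.2⟩).1.trans_le (min_le_right _ _)
    have h2 := (ht₁b ht).1.trans_le (min_le_right _ _)
    have := dist_triangle_right (p s) (p t) (p 1)
    rw [mem_ball]
    linarith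
  have hφsub : ∀ z ∈ ball (p t) ρ,
      HasDerivAt (fun z => φ (z - p t)) (Φ (φ (z - p t))) z := by
    intro z hz
    have hz' : z - p t ∈ ball (0 : ℂ) ρ := by simpa [dist_eq_norm] using hz
    simpa using (hφ _ hz').1.comp_sub_const z (p t)
  have hev : (fun z => φ (z - p t)) =ᶠ[𝓝 (p t)] fun z => (z, f t z, deriv (f t) z) := by
    refine eventuallyEq_of_hasDerivAt_smul (Φ := Φ) (k := fun _ => 1) ?_ continuousAt_const ?_ ?_ ?_
    · simp only [sub_self, hφ0]
      exact hΦan _ (h.analyticAt_left t htI) (h.analyticAt_right t htI)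
    · filter_upwards [ball_mem_nhds (p t) hρ] with z hz
      simpa using hφsub z hz
    · filter_upwards [h.eventually_hasDerivAt htI] with z hz
      simpa [hΦ] using (hasDerivAt_id z).prodMk (hz.1.prodMk hz.2)
    · simp [hφ0]
  set g : ℂ → ℂ := fun z => (φ (z - p t)).2.1 with hg
  have hgan : AnalyticOnNhd ℂ g (ball (p t) ρ) :=
    DifferentiableOn.analyticOnNhd (fun z hz =>
      ((hφsub z hz).differentiableAt.snd.fst).differentiableWithinAt) isOpen_ball
  have hgcont : IsContinuationFrom t p (fun _ => g) := fun s hs =>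
    ⟨hgan _ (hclose s hs), Eventually.of_forall fun _ => EventuallyEq.rfl⟩
  have hpt : ContinuousOn p (Ico t 1) :=
    hp.mono fun s hs => ⟨htI.1.trans hs.1, hs.2.le⟩
  refine hsing ⟨g, hgan _ ?_, ?_⟩
  · have h2 := (ht₁b ht).1.trans_le (min_le_right _ _)
    rw [mem_ball, dist_comm]
    linarith
  · filter_upwards [Ico_mem_nhdsLT htI.2] with s hs
    refine (h.continuation.mono htI.1).eventuallyEq hgcont hpt ⟨le_rfl, htI.2⟩ ?_ hs
    filter_upwards [hev] with z hz
    simp [hg, hz]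

/-! ### Ramified coordinates and Puiseux expansions -/

/-- An analytic function whose derivative has a double zero is, up to an additive constant, the
cube of a local coordinate. -/
theorem AnalyticAt.exists_eq_add_pow_three {Z m : ℂ → ℂ} (hZ : AnalyticAt ℂ Z 0)
    (hm : AnalyticAt ℂ m 0) (hm0 : m 0 ≠ 0) (hd : ∀ᶠ u in 𝓝 0, deriv Z u = u ^ 2 * m u) :
    ∃ ω : ℂ → ℂ, AnalyticAt ℂ ω 0 ∧ ω 0 = 0 ∧ deriv ω 0 ≠ 0 ∧ ∀ᶠ u in 𝓝 0, Z u = Z 0 + ω u ^ 3 := by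
  have h2 : analyticOrderAt (deriv Z) 0 = (2 : ℕ) :=
    hZ.deriv.analyticOrderAt_eq_natCast.2 ⟨m, hm, hm0, by simpa using hd⟩
  have h3 : analyticOrderAt (Z · - Z 0) 0 = (3 : ℕ) := by
    rw [← hZ.analyticOrderAt_deriv_add_one, h2]
    norm_num
  obtain ⟨g, hg, hg0, hgZ⟩ :=
    (hZ.fun_sub analyticAt_const).analyticOrderAt_eq_natCast.1 h3
  obtain ⟨d, hd3⟩ : ∃ d : ℂ, d ^ 3 = g 0 :=
    ⟨g 0 ^ ((3 : ℕ)⁻¹ : ℂ), Complex.cpow_nat_inv_pow _ (by norm_num)⟩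
  have hd0 : d ≠ 0 := fun h => hg0 (by rw [← hd3, h]; simp)
  have hroot : AnalyticAt ℂ (fun u => d * (g u / g 0) ^ ((3 : ℕ)⁻¹ : ℂ)) 0 := by
    refine analyticAt_const.mul ((hg.div_const).cpow analyticAt_const ?_)
    simp [hg0]
  refine ⟨fun u => u * (d * (g u / g 0) ^ ((3 : ℕ)⁻¹ : ℂ)), analyticAt_id.mul hroot, by simp, ?_, ?_⟩
  · have := (hasDerivAt_id (0 : ℂ)).mul hroot.differentiableAt.hasDerivAt
    have h4 : deriv (fun u => u * (d * (g u / g 0) ^ ((3 : ℕ)⁻¹ : ℂ))) 0 = d := by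
      refine (this.deriv).trans ?_
      simp [hg0]
    rw [h4]
    exact hd0
  · filter_upwards [hgZ] with u hu
    rw [mul_pow, mul_pow, Complex.cpow_nat_inv_pow _ (by norm_num), hd3]
    simp only [sub_zero, smul_eq_mul] at hu
    field_simp
    rw [← hu]
    ring

/-- The inverse of a local coordinate `ω` vanishing at `0` is again one, written as `w * s w`. -/
theorem AnalyticAt.exists_inverse_coordinate {ω : ℂ → ℂ} (hω : AnalyticAt ℂ ω 0) (h0 : ω 0 = 0)
    (hd : deriv ω 0 ≠ 0) : ∃ s : ℂ → ℂ, AnalyticAt ℂ s 0 ∧ s 0 ≠ 0 ∧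
      (∀ᶠ u in 𝓝 0, ω u * s (ω u) = u) ∧ ∀ᶠ w in 𝓝 0, ω (w * s w) = w := by
  set τ := hω.hasStrictDerivAt.localInverse _ _ _ hd with hτ
  have hτa : AnalyticAt ℂ τ 0 := by
    have := hω.analyticAt_localInverse hd
    rwa [h0] at this
  have hl : ∀ᶠ u in 𝓝 0, τ (ω u) = u := hω.hasStrictDerivAt.eventually_left_inverse hd
  have hr : ∀ᶠ w in 𝓝 0, ω (τ w) = w := by
    have := hω.hasStrictDerivAt.eventually_right_inverse hd
    rwa [h0] at this
  have hτ0 : τ 0 = 0 := by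
    have := hl.self_of_nhds
    rwa [h0] at this
  have hτd : HasDerivAt τ (deriv ω 0)⁻¹ 0 := by
    have := (hω.hasStrictDerivAt.to_localInverse hd).hasDerivAt
    rwa [h0] at this
  have h1 : analyticOrderAt τ 0 = (1 : ℕ) := by
    have h2 := hτa.analyticOrderAt_deriv_add_one
    have h3 : analyticOrderAt (deriv τ) 0 = 0 :=
      analyticOrderAt_eq_zero.2 (Or.inr (by rw [hτd.deriv]; exact inv_ne_zero hd))
    simp only [h3, hτ0, sub_zero] at h2
    rw [← h2]
    simp
  obtain ⟨s, hs, hs0, hsτ⟩ := hτa.analyticOrderAt_eq_natCast.1 h1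
  have hsτ' : ∀ᶠ w in 𝓝 0, τ w = w * s w := by simpa using hsτ
  refine ⟨s, hs, hs0, ?_, ?_⟩
  · have hωt : Tendsto ω (𝓝 0) (𝓝 0) := by simpa [h0] using hω.continuousAt.tendsto
    filter_upwards [hl, hωt.eventually hsτ'] with u h2 h3
    rw [← h3, h2]
  · filter_upwards [hr, hsτ'] with w h2 h3
    rw [← h3, h2]

open Metric in
/-- `f` has, at the end of the path `p`, a Puiseux representation in `w = (z - p 1) ^ (1 / n)`
with principal exponent `-j₀`, stated through the analytic function `w ^ j₀ * f`. -/
def HasRootExpansionAtEnd (n j₀ : ℕ) (p : ℝ → ℂ) (f : ℝ → ℂ → ℂ) : Prop :=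
  ∃ (h : ℂ → ℂ) (r : ℝ), 0 < r ∧ DifferentiableOn ℂ h (ball 0 r) ∧ h 0 ≠ 0 ∧
    ∃ t₀ ∈ Ico (0 : ℝ) 1, ∃ σ : ℝ → ℂ, ContinuousOn σ (Ico t₀ 1) ∧
      ∀ t ∈ Ico t₀ 1, σ t ≠ 0 ∧ ‖σ t‖ < r ∧ p t = p 1 + σ t ^ n ∧
        ∀ᶠ w in 𝓝 (σ t), w ^ j₀ * f t (p 1 + w ^ n) = h w

theorem mul_zpow_sub_eq {w : ℂ} (hw : w ≠ 0) (c : ℂ) (j j₀ : ℕ) :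
    c * w ^ ((j : ℤ) - (j₀ : ℤ)) = (w ^ j₀)⁻¹ * (c * w ^ j) := by
  rw [zpow_sub₀ hw, zpow_natCast, zpow_natCast]
  field_simp

theorem hasPuiseuxPoleAtEnd_of_rootExpansion {n j₀ : ℕ} {p : ℝ → ℂ} {f : ℝ → ℂ → ℂ} (hn : 0 < n)
    (hj₀ : 0 < j₀) (H : HasRootExpansionAtEnd n j₀ p f) : HasPuiseuxPoleAtEnd n p f := by
  obtain ⟨h, r, hr, hd, h0, t₀, ht₀, σ, hσ, hrep⟩ := H
  have hsum : ∀ w : ℂ, w ≠ 0 → ‖w‖ < r →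
      HasSum (fun j : ℕ => ((j.factorial : ℂ)⁻¹ * iteratedDeriv j h 0) *
        w ^ ((j : ℤ) - (j₀ : ℤ))) ((w ^ j₀)⁻¹ * h w) := by
    intro w hw hwr
    have h1 := Complex.hasSum_taylorSeries_on_ball hd
      (show w ∈ Metric.ball (0 : ℂ) r by simpa using hwr)
    simp only [mul_zpow_sub_eq hw]
    refine HasSum.mul_left _ ?_
    simpa only [sub_zero, smul_eq_mul, mul_assoc, mul_comm (w ^ _)] using h1
  refine ⟨hn, j₀, fun j => (j.factorial : ℂ)⁻¹ * iteratedDeriv j h 0, r, hj₀, by simpa using h0, hr,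
    fun w hw hwr => (hsum w hw hwr).summable, t₀, ht₀, σ, hσ, fun t ht => ?_⟩
  obtain ⟨h1, h2, h3, h4⟩ := hrep t ht
  refine ⟨h1, h2, h3, ?_⟩
  filter_upwards [h4, eventually_ne_nhds h1,
    continuous_norm.continuousAt.eventually_lt_const h2] with w e1 e2 e3
  have := hsum w e2 e3
  rwa [← e1, inv_mul_cancel_left₀ (pow_ne_zero _ e2)] at this

open scoped ENNReal in
theorem HasPuiseuxPoleAtEnd.exists_rootExpansion {n : ℕ} {p : ℝ → ℂ} {f : ℝ → ℂ → ℂ}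
    (H : HasPuiseuxPoleAtEnd n p f) : ∃ j₀, 0 < j₀ ∧ HasRootExpansionAtEnd n j₀ p f := by
  obtain ⟨-, j₀, c, r, hj₀, hc0, hr, hsum, t₀, ht₀, σ, hσ, hrep⟩ := H
  set q := FormalMultilinearSeries.ofScalars ℂ c with hq
  have hsum' : ∀ w : ℂ, w ≠ 0 → ‖w‖ < r → Summable fun j : ℕ => c j * w ^ j := by
    intro w hw hwr
    refine ((hsum w hw hwr).mul_left (w ^ j₀)).congr fun j => ?_
    rw [mul_zpow_sub_eq hw, mul_inv_cancel_left₀ (pow_ne_zero _ hw)]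
  have hrad : ENNReal.ofReal r ≤ q.radius := by
    refine ENNReal.le_of_forall_nnreal_lt fun x hx => ?_
    rcases eq_or_ne x 0 with rfl | hx0
    · simp
    have hxr : (x : ℝ) < r := by
      rw [← ENNReal.ofReal_coe_nnreal] at hx
      exact (ENNReal.ofReal_lt_ofReal_iff hr).1 hx
    refine q.le_radius_of_tendsto (l := 0) ?_
    have h1 := (hsum' (x : ℂ) (by exact_mod_cast hx0) (by simpa using hxr)).tendsto_atTop_zero.norm
    simpa [hq, FormalMultilinearSeries.ofScalars_norm] using h1
  have hrad0 : 0 < q.radius := (ENNReal.ofReal_pos.2 hr).trans_le hrad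
  have hball := (q.hasFPowerSeriesOnBall hrad0).mono (ENNReal.ofReal_pos.2 hr) hrad
  have hqs : ∀ w : ℂ, ‖w‖ < r → HasSum (fun j : ℕ => c j * w ^ j) (q.sum w) := by
    intro w hw
    have h1 := hball.hasSum (y := w) (by
      rw [Metric.eball_ofReal]
      simpa using hw)
    simpa [hq, FormalMultilinearSeries.ofScalars_apply_eq, mul_comm] using h1
  have hq0 : q.sum 0 = c 0 := by
    have h1 := hqs 0 (by simpa using hr)
    have h2 : HasSum (fun j : ℕ => c j * (0 : ℂ) ^ j) (c 0) := by
      simpa using hasSum_single (f := fun j : ℕ => c j * (0 : ℂ) ^ j) 0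
        (fun j hj => by simp [hj])
    exact h1.unique h2
  refine ⟨j₀, hj₀, q.sum, r, hr, ?_, by rwa [hq0], t₀, ht₀, σ, hσ, fun t ht => ?_⟩
  · have := hball.differentiableOn
    rwa [Metric.eball_ofReal] at this
  obtain ⟨h1, h2, h3, h4⟩ := hrep t ht
  refine ⟨h1, h2, h3, ?_⟩
  filter_upwards [h4, eventually_ne_nhds h1,
    continuous_norm.continuousAt.eventually_lt_const h2] with w e1 e2 e3
  refine HasSum.unique ?_ (hqs w e3)
  simpa only [mul_zpow_sub_eq e2, mul_inv_cancel_left₀ (pow_ne_zero _ e2)]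
    using e1.mul_left (w ^ j₀)

/-- The order of vanishing at `0` is determined by the function. -/
theorem eq_of_pow_mul_eventuallyEq {a b : ℕ} {g h : ℂ → ℂ} (hg : AnalyticAt ℂ g 0)
    (hh : AnalyticAt ℂ h 0) (hg0 : g 0 ≠ 0) (hh0 : h 0 ≠ 0)
    (heq : ∀ᶠ s in 𝓝 0, s ^ a * g s = s ^ b * h s) : a = b := by
  have ha : AnalyticAt ℂ (fun s => s ^ a * g s) 0 := (analyticAt_id.pow a).mul hg
  have h1 : analyticOrderAt (fun s => s ^ a * g s) 0 = a :=
    ha.analyticOrderAt_eq_natCast.2 ⟨g, hg, hg0, by simp⟩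
  have h2 : analyticOrderAt (fun s => s ^ a * g s) 0 = b :=
    ha.analyticOrderAt_eq_natCast.2 ⟨h, hh, hh0, by simpa using heq⟩
  exact_mod_cast h1.symm.trans h2

open Metric in
/-- Two root expansions of the same function with coprime ramification indices, compared in a
common uniformizer `s` with `σ = s ^ m` and `σ' = s ^ 3`, have proportional exponents. -/
theorem HasRootExpansionAtEnd.exponent_eq {m j j' : ℕ} {p : ℝ → ℂ} {f : ℝ → ℂ → ℂ}
    (hm : m = 1 ∨ m = 2) (H : HasRootExpansionAtEnd 3 j p f)
    (H' : HasRootExpansionAtEnd m j' p f) : 3 * j' = m * j := by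
  obtain ⟨h, r, hr, hd, h0, t₀, ht₀, σ, -, hrep⟩ := H
  obtain ⟨h', r', hr', hd', h0', t₀', ht₀', σ', -, hrep'⟩ := H'
  set t := max t₀ t₀'
  obtain ⟨e1, e2, e3, e4⟩ := hrep t ⟨le_max_left _ _, max_lt ht₀.2 ht₀'.2⟩
  obtain ⟨e1', e2', e3', e4'⟩ := hrep' t ⟨le_max_right _ _, max_lt ht₀.2 ht₀'.2⟩
  have hm0 : m ≠ 0 := by omega
  have hσσ : σ t ^ 3 = σ' t ^ m := by
    have := e3.symm.trans e3'
    exact add_left_cancel this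
  obtain ⟨s₀, hs, hs'⟩ : ∃ s₀ : ℂ, s₀ ^ m = σ t ∧ s₀ ^ 3 = σ' t := by
    rcases hm with rfl | rfl
    · exact ⟨σ t, by simp, by simpa using hσσ⟩
    · refine ⟨σ' t / σ t, ?_, ?_⟩
      · rw [div_pow, ← hσσ]
        field_simp
      · rw [div_pow, hσσ]
        field_simp
  have hcm : Continuous fun x : ℝ => x ^ m := continuous_pow m
  have hc3 : Continuous fun x : ℝ => x ^ 3 := continuous_pow 3
  have hev : ∀ᶠ x in 𝓝[>] ‖s₀‖, x ^ m < r ∧ x ^ 3 < r' :=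
    nhdsWithin_le_nhds ((hcm.continuousAt.eventually_lt_const (by simpa only [← norm_pow, hs] using e2)).and
      (hc3.continuousAt.eventually_lt_const (by simpa only [← norm_pow, hs'] using e2')))
  obtain ⟨δ, ⟨hδm, hδ3⟩, hδ⟩ := (hev.and self_mem_nhdsWithin).exists
  have hδ' : ‖s₀‖ < δ := hδ
  have hδ0 : 0 < δ := (norm_nonneg _).trans_lt hδ'
  have hmapm : MapsTo (fun s : ℂ => s ^ m) (ball 0 δ) (ball 0 r) := fun s hs => by
    have : ‖s‖ < δ := by simpa using hs
    simpa using (pow_le_pow_left₀ (norm_nonneg s) this.le m).trans_lt hδm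
  have hmap3 : MapsTo (fun s : ℂ => s ^ 3) (ball 0 δ) (ball 0 r') := fun s hs => by
    have : ‖s‖ < δ := by simpa using hs
    simpa using (pow_le_pow_left₀ (norm_nonneg s) this.le 3).trans_lt hδ3
  have hgm : DifferentiableOn ℂ (fun s => h (s ^ m)) (ball 0 δ) :=
    hd.comp (differentiable_id.pow m).differentiableOn hmapm
  have hg3 : DifferentiableOn ℂ (fun s => h' (s ^ 3)) (ball 0 δ) :=
    hd'.comp (differentiable_id.pow 3).differentiableOn hmap3
  have hgm0 : AnalyticAt ℂ (fun s => h (s ^ m)) 0 := hgm.analyticAt (ball_mem_nhds _ hδ0)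
  have hg30 : AnalyticAt ℂ (fun s => h' (s ^ 3)) 0 := hg3.analyticAt (ball_mem_nhds _ hδ0)
  have heq : EqOn (fun s => s ^ (3 * j') * h (s ^ m)) (fun s => s ^ (m * j) * h' (s ^ 3))
      (ball 0 δ) := by
    refine AnalyticOnNhd.eqOn_of_preconnected_of_eventuallyEq (𝕜 := ℂ) (z₀ := s₀) ?_ ?_
      (convex_ball _ _).isPreconnected (by simpa using hδ') ?_
    · exact DifferentiableOn.analyticOnNhd (by fun_prop) isOpen_ball
    · exact DifferentiableOn.analyticOnNhd (by fun_prop) isOpen_ball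
    · have t1 : Tendsto (fun s : ℂ => s ^ m) (𝓝 s₀) (𝓝 (σ t)) := by
        rw [← hs]
        exact (continuous_pow m).tendsto s₀
      have t2 : Tendsto (fun s : ℂ => s ^ 3) (𝓝 s₀) (𝓝 (σ' t)) := by
        rw [← hs']
        exact (continuous_pow 3).tendsto s₀
      filter_upwards [t1.eventually e4, t2.eventually e4'] with s h1 h2
      rw [← h1, ← h2, ← pow_mul, ← pow_mul, ← pow_mul, ← pow_mul, mul_comm m 3]
      ring
  refine eq_of_pow_mul_eventuallyEq hgm0 hg30 (by simpa [hm0] using h0) (by simpa using h0') ?_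
  filter_upwards [ball_mem_nhds (0 : ℂ) hδ0] with s hs using heq hs

/-- A cube-root expansion with leading exponent `-2 / 3` cannot have smaller ramification index
`m ∈ {1, 2}`: comparison of exponents would give `3 * j' = 2 * m`. -/
theorem HasRootExpansionAtEnd.hasRootTypeAlgebraicPoleAtEnd {p : ℝ → ℂ} {f : ℝ → ℂ → ℂ}
    (H : HasRootExpansionAtEnd 3 2 p f) : HasRootTypeAlgebraicPoleAtEnd 3 p f := by
  refine ⟨by norm_num, hasPuiseuxPoleAtEnd_of_rootExpansion (by norm_num) (by norm_num) H,
    fun m hm hP => ?_⟩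
  have hm0 := hP.1
  obtain ⟨j', -, H'⟩ := hP.exists_rootExpansion
  have := H.exponent_eq (by omega) H'
  omega

/-! ### The regular system at a pole -/

/-- The coordinate `u = y ^ (-1 / 2)` near a pole; the choice of the root is dictated by `v = y'`
through `v ≈ √(2 / 5) u⁻⁵`. -/
noncomputable def rootCoord (y v : ℂ) : ℂ := y ^ 2 * (v ^ 2 / y ^ 5) ^ (2⁻¹ : ℂ) / v

theorem cpow_two_inv_sq (w : ℂ) : (w ^ (2⁻¹ : ℂ)) ^ 2 = w := by
  exact_mod_cast Complex.cpow_nat_inv_pow w two_ne_zero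

theorem rootCoord_sq {y v : ℂ} (hy : y ≠ 0) (hv : v ≠ 0) : rootCoord y v ^ 2 = 1 / y := by
  rw [rootCoord, div_pow, mul_pow, cpow_two_inv_sq]
  field_simp

theorem rootCoord_ne_zero {y v : ℂ} (hy : y ≠ 0) (hv : v ≠ 0) : rootCoord y v ≠ 0 := by
  intro h
  have := rootCoord_sq hy hv
  rw [h, zero_pow two_ne_zero] at this
  exact one_div_ne_zero hy this.symm

theorem mul_rootCoord_pow_five {y v : ℂ} (hy : y ≠ 0) (hv : v ≠ 0) :
    v * rootCoord y v ^ 5 = (v ^ 2 / y ^ 5) ^ (2⁻¹ : ℂ) := by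
  have h : v * rootCoord y v ^ 5 = v * rootCoord y v * (rootCoord y v ^ 2) ^ 2 := by ring
  rw [h, rootCoord_sq hy hv, rootCoord]
  field_simp

namespace CoeffJet

variable (J : CoeffJet)

/-- Half the linear coefficient of the quadratic equation satisfied by `v * u ^ 5`. -/
noncomputable def shift (u : ℂ) : ℂ := J.c₁ * u ^ 7 + J.c₂ * u ^ 9 + J.c₃ * u ^ 11

/-- The discriminant of the quadratic equation satisfied by `v * u ^ 5`. -/
noncomputable def discr (u W : ℂ) : ℂ :=
  J.shift u ^ 2 + 2 / 5 + 2 / 3 * J.A * u ^ 4 + J.β * u ^ 6 + 2 * J.γ * u ^ 8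
    - 2 * J.c₄ * u ^ 12 + 2 * W * u ^ 10

/-- The value of `v * u ^ 5` in terms of the coordinate `u` and the corrected energy `W`. -/
noncomputable def slope (u W : ℂ) : ℂ := J.discr u W ^ (2⁻¹ : ℂ) - J.shift u

/-- The value of `energy / y ^ 2` in terms of `u`, of `W` and of `q = v * u ^ 5`. -/
noncomputable def scaledEnergy (u W q : ℂ) : ℂ :=
  W * u ^ 4 - (J.c₁ * (q * u) + J.c₂ * (q * u ^ 3) + J.c₃ * (q * u ^ 5) + J.c₄ * u ^ 6)

/-- The region where the coordinates `u` and `W` describe the solution. -/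
structure NearPole (y v : ℂ) : Prop where
  two_lt : 2 < ‖y‖
  ne_zero : v ≠ 0
  mem_slitPlane : v ^ 2 / y ^ 5 ∈ Complex.slitPlane
  re_pos : 0 < ((v ^ 2 / y ^ 5) ^ (2⁻¹ : ℂ) + J.shift (rootCoord y v)).re

variable {J}

theorem NearPole.left_ne_zero {y v : ℂ} (h : J.NearPole y v) : y ≠ 0 :=
  norm_pos_iff.1 (by linarith [h.two_lt])

/-- Near a pole, `v * u ^ 5` is the root with positive real part (after the shift) of its quadratic
equation, which the principal square root picks out. -/
theorem NearPole.slope_eq {y v : ℂ} (h : J.NearPole y v) :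
    J.slope (rootCoord y v) (J.energy y v + J.correction y v) = v * rootCoord y v ^ 5 := by
  have hy := h.left_ne_zero
  have hv := h.ne_zero
  have hu := rootCoord_ne_zero hy hv
  have hre := h.re_pos
  rw [← mul_rootCoord_pow_five hy hv] at hre
  have hyu : y = 1 / rootCoord y v ^ 2 := by rw [rootCoord_sq hy hv, one_div_one_div]
  have hd : J.discr (rootCoord y v) (J.energy y v + J.correction y v) =
      (v * rootCoord y v ^ 5 + J.shift (rootCoord y v)) ^ 2 := by
    generalize rootCoord y v = u at hu hyu
    subst hyu
    simp only [discr, energy, correction, shift]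
    field_simp
    ring
  rw [slope, hd, Complex.sq_cpow_two_inv hre, add_sub_cancel_right]

theorem NearPole.remainder_eq {y v : ℂ} (h : J.NearPole y v) :
    J.remainder (1 / y) (J.energy y v / y ^ 2) (v / y ^ 3) =
      J.remainder (rootCoord y v ^ 2)
        (J.scaledEnergy (rootCoord y v) (J.energy y v + J.correction y v) (v * rootCoord y v ^ 5))
        (v * rootCoord y v ^ 5 * rootCoord y v) := by
  have hy := h.left_ne_zero
  have hv := h.ne_zero
  have hu := rootCoord_ne_zero hy hv
  have hyu : y = 1 / rootCoord y v ^ 2 := by rw [rootCoord_sq hy hv, one_div_one_div]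
  generalize rootCoord y v = u at hu hyu
  subst hyu
  congr 1
  · field_simp
  · simp only [scaledEnergy, energy, correction]
    field_simp
    ring
  · field_simp

/-- A pole of bounded corrected energy has `v ^ 2 / y ^ 5` close to `2 / 5`. -/
theorem norm_sq_div_sub_le {M : ℝ} (h : J.BoundedBy M) {B : ℝ} {y v : ℂ} (hy : 1 ≤ ‖y‖)
    (hB : ‖J.energy y v + J.correction y v‖ ≤ B) :
    ‖v ^ 2 / y ^ 5 - 2 / 5‖ ≤
      (4 * M + 2 * (B + 3 * M * (1 + 4 * (1 + 4 * M + 9 * M ^ 2) * (B + 1)) + M)) / ‖y‖ := by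
  have hM := zero_le_one.trans h.one_le
  have hB0 : 0 ≤ B := (norm_nonneg _).trans hB
  have hypos : 0 < ‖y‖ := by linarith
  have hy0 : y ≠ 0 := norm_pos_iff.1 hypos
  set C := 4 * (1 + 4 * M + 9 * M ^ 2) * (B + 1) with hC
  have hC0 : 0 ≤ C := by positivity
  have hv := norm_sq_le h (κ := 1) (v := v) hy le_rfl (by simp) (fun h => absurd h (not_lt.2 hy))
  rw [one_mul] at hv
  have hY5 : 1 ≤ ‖y‖ ^ 5 := one_le_pow₀ hy
  have hv2 : ‖v‖ ^ 2 ≤ C * ‖y‖ ^ 6 := by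
    refine hv.trans ?_
    rw [hC, mul_assoc (4 * (1 + 4 * M + 9 * M ^ 2))]
    gcongr
    have h1 : ‖y‖ ^ 5 ≤ ‖y‖ ^ 6 := pow_le_pow_right₀ hy (by norm_num)
    have h2 : B * 1 ≤ B * ‖y‖ ^ 6 := by gcongr; linarith
    linarith
  have hv3 : ‖v‖ ≤ (1 + C) * ‖y‖ ^ 3 := by
    refine le_of_sq_le_sq ?_ (by positivity)
    refine hv2.trans ?_
    have : C ≤ (1 + C) ^ 2 := by nlinarith
    calc C * ‖y‖ ^ 6 ≤ (1 + C) ^ 2 * ‖y‖ ^ 6 := by gcongr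
      _ = _ := by ring
  have hK : ‖J.energy y v‖ ≤ B + 3 * M * ((1 + C) * ‖y‖ ^ 3) + M := by
    have h1 : J.energy y v = (J.energy y v + J.correction y v) - J.correction y v := by ring
    rw [h1]
    refine (norm_sub_le_of_le hB (norm_correction_le h hy v)).trans ?_
    rw [← add_assoc]
    gcongr
  have hi : ∀ k, 1 ≤ k → ‖(1 / y) ^ k‖ ≤ 1 / ‖y‖ := fun k hk => by
    rw [norm_pow, norm_div, norm_one]
    have h1 : 1 / ‖y‖ ≤ 1 := div_le_one_of_le₀ hy hypos.le
    exact pow_le_of_le_one (by positivity) h1 (by omega)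
  have heq : v ^ 2 / y ^ 5 - 2 / 5 = (2 / 3) * (J.A * (1 / y) ^ 2) + J.β * (1 / y) ^ 3
      + 2 * (J.γ * (1 / y) ^ 4) + 2 * (J.energy y v * (1 / y) ^ 5) := by
    rw [energy]
    field_simp
    ring
  have hE5 : ‖J.energy y v * (1 / y) ^ 5‖ ≤ (B + 3 * M * (1 + C) + M) * (1 / ‖y‖) := by
    rw [norm_mul, norm_pow, norm_div, norm_one]
    have h3 : 1 ≤ ‖y‖ ^ 3 := one_le_pow₀ hy
    have h1 : ‖J.energy y v‖ ≤ (B + 3 * M * (1 + C) + M) * ‖y‖ ^ 3 := by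
      refine hK.trans ?_
      have h4 : B * 1 ≤ B * ‖y‖ ^ 3 := by gcongr
      have h5 : M * 1 ≤ M * ‖y‖ ^ 3 := by gcongr
      linarith
    calc ‖J.energy y v‖ * (1 / ‖y‖) ^ 5
        ≤ (B + 3 * M * (1 + C) + M) * ‖y‖ ^ 3 * (1 / ‖y‖) ^ 5 := by gcongr
      _ = (B + 3 * M * (1 + C) + M) * (1 / ‖y‖) ^ 2 := by field_simp
      _ ≤ _ := by
        gcongr
        exact pow_le_of_le_one (by positivity) (div_le_one_of_le₀ hy hypos.le) two_ne_zero
  have n23 : ‖(2 / 3 : ℂ)‖ ≤ 1 := by norm_num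
  have m2 : ‖(2 : ℂ)‖ ≤ 2 := by norm_num
  rw [heq]
  refine (norm_add_le_of_le (norm_add_le_of_le (norm_add_le_of_le
    (norm_mul_le_of_le n23 (norm_mul_le_of_le h.A (hi 2 (by norm_num))))
    (norm_mul_le_of_le h.β (hi 3 (by norm_num))))
    (norm_mul_le_of_le m2 (norm_mul_le_of_le h.γ (hi 4 (by norm_num)))))
    (norm_mul_le_of_le m2 hE5)).trans (le_of_eq ?_)
  field_simp
  ring

theorem norm_shift_le {M : ℝ} (h : J.BoundedBy M) {u : ℂ} (hu : ‖u‖ ≤ 1) :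
    ‖J.shift u‖ ≤ 3 * M * ‖u‖ := by
  have hk : ∀ k, k ≠ 0 → ‖u ^ k‖ ≤ ‖u‖ := fun k hk => by
    rw [norm_pow]
    exact pow_le_of_le_one (norm_nonneg _) hu hk
  refine (norm_add_le_of_le (norm_add_le_of_le (norm_mul_le_of_le h.c₁ (hk 7 (by norm_num)))
    (norm_mul_le_of_le h.c₂ (hk 9 (by norm_num))))
    (norm_mul_le_of_le h.c₃ (hk 11 (by norm_num)))).trans (le_of_eq ?_)
  ring

end CoeffJet

section PoleField

/-- The equation near a pole, as an autonomous system for `(u, z, W)` with independent variable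
`u`. It is regular at `u = 0`. -/
noncomputable def poleField (a b : ℂ) (β γ : ℂ → ℂ) (x : ℂ × ℂ × ℂ) : ℂ × ℂ × ℂ :=
  let J := coeffJet a b β γ x.2.1
  let q := J.slope x.1 x.2.2
  (1, -2 * x.1 ^ 2 / q,
    J.remainder (x.1 ^ 2) (J.scaledEnergy x.1 x.2.2 q) (q * x.1) * (-2 * x.1 ^ 2 / q))

variable {a b : ℂ} {β γ : ℂ → ℂ}

theorem two_fifths_mem_slitPlane : (2 / 5 : ℂ) ∈ Complex.slitPlane := by
  rw [Complex.mem_slitPlane_iff]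
  left
  norm_num

theorem slope_zero (J : CoeffJet) (W : ℂ) : J.slope 0 W = (2 / 5 : ℂ) ^ (2⁻¹ : ℂ) := by
  simp [CoeffJet.slope, CoeffJet.discr, CoeffJet.shift]

theorem slope_zero_ne_zero (J : CoeffJet) (W : ℂ) : J.slope 0 W ≠ 0 := by
  rw [slope_zero]
  intro h
  have := cpow_two_inv_sq (2 / 5)
  rw [h] at this
  norm_num at this

theorem analyticAt_slope_and_poleField {x : ℂ × ℂ × ℂ} (hx : x.1 = 0)
    (hβ : AnalyticAt ℂ β x.2.1) (hγ : AnalyticAt ℂ γ x.2.1) :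
    AnalyticAt ℂ (fun x : ℂ × ℂ × ℂ => (coeffJet a b β γ x.2.1).slope x.1 x.2.2) x ∧
      AnalyticAt ℂ (poleField a b β γ) x := by
  have hu : AnalyticAt ℂ (fun x : ℂ × ℂ × ℂ => x.1) x := analyticAt_fst
  have hz := analyticAt_snd_fst x
  have hW := analyticAt_snd_snd x
  have b0 : AnalyticAt ℂ (fun x : ℂ × ℂ × ℂ => β x.2.1) x := hβ.comp_of_eq hz rfl
  have b1 : AnalyticAt ℂ (fun x : ℂ × ℂ × ℂ => deriv β x.2.1) x := hβ.deriv.comp_of_eq hz rfl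
  have b2 : AnalyticAt ℂ (fun x : ℂ × ℂ × ℂ => deriv (deriv β) x.2.1) x :=
    hβ.deriv.deriv.comp_of_eq hz rfl
  have b3 : AnalyticAt ℂ (fun x : ℂ × ℂ × ℂ => deriv (deriv (deriv β)) x.2.1) x :=
    hβ.deriv.deriv.deriv.comp_of_eq hz rfl
  have g0 : AnalyticAt ℂ (fun x : ℂ × ℂ × ℂ => γ x.2.1) x := hγ.comp_of_eq hz rfl
  have g1 : AnalyticAt ℂ (fun x : ℂ × ℂ × ℂ => deriv γ x.2.1) x := hγ.deriv.comp_of_eq hz rfl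
  have g2 : AnalyticAt ℂ (fun x : ℂ × ℂ × ℂ => deriv (deriv γ) x.2.1) x :=
    hγ.deriv.deriv.comp_of_eq hz rfl
  have hshift : AnalyticAt ℂ (fun x : ℂ × ℂ × ℂ => (coeffJet a b β γ x.2.1).shift x.1) x := by
    simp only [CoeffJet.shift, CoeffJet.c₁, CoeffJet.c₂, CoeffJet.c₃, coeffJet]
    fun_prop
  have hdiscr : AnalyticAt ℂ
      (fun x : ℂ × ℂ × ℂ => (coeffJet a b β γ x.2.1).discr x.1 x.2.2) x := by
    simp only [CoeffJet.discr]
    simp only [CoeffJet.c₄, coeffJet] at hshift ⊢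
    fun_prop
  have hslope : AnalyticAt ℂ
      (fun x : ℂ × ℂ × ℂ => (coeffJet a b β γ x.2.1).slope x.1 x.2.2) x := by
    refine (hdiscr.cpow analyticAt_const ?_).sub hshift
    have : (coeffJet a b β γ x.2.1).discr x.1 x.2.2 = 2 / 5 := by
      simp [CoeffJet.discr, CoeffJet.shift, hx]
    rw [this]
    exact two_fifths_mem_slitPlane
  refine ⟨hslope, ?_⟩
  have hne : (coeffJet a b β γ x.2.1).slope x.1 x.2.2 ≠ 0 := by
    rw [hx]
    exact slope_zero_ne_zero _ _
  have hdz : AnalyticAt ℂ (fun x : ℂ × ℂ × ℂ =>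
      -2 * x.1 ^ 2 / (coeffJet a b β γ x.2.1).slope x.1 x.2.2) x :=
    AnalyticAt.fun_div (by fun_prop) hslope hne
  have hdW : AnalyticAt ℂ (fun x : ℂ × ℂ × ℂ => (coeffJet a b β γ x.2.1).remainder (x.1 ^ 2)
      ((coeffJet a b β γ x.2.1).scaledEnergy x.1 x.2.2
        ((coeffJet a b β γ x.2.1).slope x.1 x.2.2))
      ((coeffJet a b β γ x.2.1).slope x.1 x.2.2 * x.1)) x := by
    have key : ∀ {q : ℂ × ℂ × ℂ → ℂ}, AnalyticAt ℂ q x → AnalyticAt ℂ (fun x : ℂ × ℂ × ℂ =>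
        (coeffJet a b β γ x.2.1).remainder (x.1 ^ 2)
          ((coeffJet a b β γ x.2.1).scaledEnergy x.1 x.2.2 (q x)) (q x * x.1)) x := by
      intro q hq
      simp only [CoeffJet.remainder, CoeffJet.scaledEnergy, CoeffJet.c₁, CoeffJet.c₂, CoeffJet.c₃,
        CoeffJet.c₄, CoeffJet.c₃', CoeffJet.c₄', coeffJet]
      fun_prop
    exact key hslope
  exact analyticAt_const.prod (hdz.prod (hdW.mul hdz))

theorem AnalyticAt.rootCoord {y v : ℂ → ℂ} {z : ℂ} (hy : AnalyticAt ℂ y z) (hv : AnalyticAt ℂ v z)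
    (hy0 : y z ≠ 0) (hv0 : v z ≠ 0) (hs : v z ^ 2 / y z ^ 5 ∈ Complex.slitPlane) :
    AnalyticAt ℂ (fun z => rootCoord (y z) (v z)) z :=
  ((hy.fun_pow 2).fun_mul (((hv.fun_pow 2).fun_div (hy.fun_pow 5) (pow_ne_zero 5 hy0)).cpow
    analyticAt_const hs)).fun_div hv hv0

theorem hasDerivAt_rootCoord {y v : ℂ → ℂ} {z : ℂ} (hy : AnalyticAt ℂ y z) (hv : AnalyticAt ℂ v z)
    (hd : HasDerivAt y (v z) z)
    (hy0 : y z ≠ 0) (hv0 : v z ≠ 0) (hs : v z ^ 2 / y z ^ 5 ∈ Complex.slitPlane) :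
    HasDerivAt (fun z => rootCoord (y z) (v z)) (-(v z * rootCoord (y z) (v z) ^ 3) / 2) z := by
  have h1 := (hy.rootCoord hv hy0 hv0 hs).differentiableAt.hasDerivAt
  have h2 := (h1.fun_pow 2).fun_mul hd
  have hconst : (fun z => rootCoord (y z) (v z) ^ 2 * y z) =ᶠ[𝓝 z] fun _ => 1 := by
    filter_upwards [hy.continuousAt.eventually_ne hy0, hv.continuousAt.eventually_ne hv0]
      with w e1 e2
    rw [rootCoord_sq e1 e2]
    field_simp
  have h3 := h2.unique ((hasDerivAt_const z (1 : ℂ)).congr_of_eventuallyEq hconst)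
  have hu := rootCoord_ne_zero hy0 hv0
  refine h1.congr_deriv ?_
  have hyu : y z = 1 / rootCoord (y z) (v z) ^ 2 := by rw [rootCoord_sq hy0 hv0, one_div_one_div]
  generalize deriv (fun z => rootCoord (y z) (v z)) z = D at h3
  generalize rootCoord (y z) (v z) = u at hu hyu h3
  rw [hyu] at h3
  field_simp at h3
  push_cast at h3
  simp only [pow_one] at h3
  refine mul_left_cancel₀ (mul_ne_zero two_ne_zero hu) ?_
  linear_combination h3

end PoleField

/-! ### The expansion at the end of the path -/

/-- The state `(u, z, W)` of a solution with value `y` and derivative `v` at `z`. -/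
noncomputable def poleState (a b : ℂ) (β γ : ℂ → ℂ) (z y v : ℂ) : ℂ × ℂ × ℂ :=
  (rootCoord y v, z, (coeffJet a b β γ z).energy y v + (coeffJet a b β γ z).correction y v)

section

variable {a b : ℂ} {β γ : ℂ → ℂ}

/-- Along a solution the state moves along `poleField`, with speed `u' = -v u ^ 3 / 2`. -/
theorem hasDerivAt_poleState {z : ℂ} (hβ : AnalyticAt ℂ β z) (hγ : AnalyticAt ℂ γ z)
    {y v : ℂ → ℂ} (hya : AnalyticAt ℂ y z) (hva : AnalyticAt ℂ v z) (hy : HasDerivAt y (v z) z)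
    (hv : HasDerivAt v ((coeffJet a b β γ z).rhs (y z)) z)
    (hn : (coeffJet a b β γ z).NearPole (y z) (v z)) :
    HasDerivAt (fun z => poleState a b β γ z (y z) (v z))
      ((-(v z * rootCoord (y z) (v z) ^ 3) / 2) •
        poleField a b β γ (poleState a b β γ z (y z) (v z))) z := by
  have hy0 := hn.left_ne_zero
  have hv0 := hn.ne_zero
  have hu := rootCoord_ne_zero hy0 hv0
  have h1 := hasDerivAt_rootCoord hya hva hy hy0 hv0 hn.mem_slitPlane
  have h2 := (hasDerivAt_energy (a := a) (b := b) hβ hγ hy hv).add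
    (hasDerivAt_correction hβ hγ hy hv hy0)
  rw [CoeffJet.energyDeriv_add_correctionDeriv _ hy0, hn.remainder_eq] at h2
  refine (h1.prodMk ((hasDerivAt_id z).prodMk h2)).congr_deriv ?_
  have hk : -(v z * rootCoord (y z) (v z) ^ 3) / 2 *
      (-2 * rootCoord (y z) (v z) ^ 2 / (v z * rootCoord (y z) (v z) ^ 5)) = 1 := by
    field_simp
  simp only [poleField, poleState, hn.slope_eq, Prod.smul_mk, smul_eq_mul, mul_one, hk]
  rw [mul_left_comm, hk, mul_one]

theorem ContinuousAt.rootCoord {y v : ℂ → ℂ} {z : ℂ} (hy : ContinuousAt y z)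
    (hv : ContinuousAt v z) (hy0 : y z ≠ 0) (hv0 : v z ≠ 0)
    (hs : v z ^ 2 / y z ^ 5 ∈ Complex.slitPlane) :
    ContinuousAt (fun z => rootCoord (y z) (v z)) z :=
  ((hy.pow 2).mul (((hv.pow 2).div (hy.pow 5) (pow_ne_zero 5 hy0)).cpow continuousAt_const
    hs)).div hv hv0

theorem eventually_nearPole {z : ℂ} (hβ : AnalyticAt ℂ β z) (hγ : AnalyticAt ℂ γ z)
    {y v : ℂ → ℂ} (hy : ContinuousAt y z) (hv : ContinuousAt v z)
    (hn : (coeffJet a b β γ z).NearPole (y z) (v z)) :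
    ∀ᶠ z' in 𝓝 z, (coeffJet a b β γ z').NearPole (y z') (v z') := by
  have hy0 := hn.left_ne_zero
  have hv0 := hn.ne_zero
  have hq : ContinuousAt (fun z => v z ^ 2 / y z ^ 5) z :=
    (hv.pow 2).div (hy.pow 5) (pow_ne_zero 5 hy0)
  have hu := hy.rootCoord hv hy0 hv0 hn.mem_slitPlane
  have b1 := hβ.deriv.continuousAt
  have g1 := hγ.deriv.continuousAt
  have hshift : ContinuousAt (fun z => (coeffJet a b β γ z).shift (rootCoord (y z) (v z))) z := by
    simp only [CoeffJet.shift, CoeffJet.c₁, CoeffJet.c₂, CoeffJet.c₃, coeffJet]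
    fun_prop
  have hre : ContinuousAt (fun z => ((v z ^ 2 / y z ^ 5) ^ (2⁻¹ : ℂ) +
      (coeffJet a b β γ z).shift (rootCoord (y z) (v z))).re) z :=
    Complex.continuous_re.continuousAt.comp
      ((hq.cpow continuousAt_const hn.mem_slitPlane).add hshift)
  filter_upwards [hy.norm.eventually_const_lt hn.two_lt, hv.eventually_ne hv0,
    hq.eventually_mem (Complex.isOpen_slitPlane.mem_nhds hn.mem_slitPlane),
    hre.eventually_const_lt hn.re_pos] with z' h1 h2 h3 h4
  exact ⟨h1, h2, h3, h4⟩

/-- Along a family of points where `y → ∞` with bounded corrected energy, `v² / y⁵ → 2 / 5` and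
the coordinate `u` tends to `0`. -/
theorem tendsto_rootCoord_and_nearPole {ι : Type*} {l : Filter ι} {J : ι → CoeffJet}
    {y v : ι → ℂ} {M B : ℝ}
    (hM : ∀ᶠ t in l, (J t).BoundedBy M) (hB : ∀ᶠ t in l, ‖(J t).modEnergy (y t) (v t)‖ ≤ B)
    (hy : Tendsto (fun t => ‖y t‖) l atTop) :
    Tendsto (fun t => rootCoord (y t) (v t)) l (𝓝 0) ∧
      ∀ᶠ t in l, (J t).NearPole (y t) (v t) := by
  have hy2 : ∀ᶠ t in l, 2 < ‖y t‖ := hy.eventually_gt_atTop 2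
  obtain ⟨K, hK⟩ : ∃ K : ℝ, ∀ᶠ t in l, ‖v t ^ 2 / y t ^ 5 - 2 / 5‖ ≤ K / ‖y t‖ := by
    refine ⟨4 * M + 2 * (B + 3 * M * (1 + 4 * (1 + 4 * M + 9 * M ^ 2) * (B + 1)) + M), ?_⟩
    filter_upwards [hM, hB, hy2] with t h1 h2 h3
    refine CoeffJet.norm_sq_div_sub_le (B := B) h1 (by linarith) ?_
    simpa [CoeffJet.modEnergy, cutoff_eq_one h3] using h2
  have hq : Tendsto (fun t => v t ^ 2 / y t ^ 5) l (𝓝 (2 / 5)) := by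
    rw [tendsto_iff_norm_sub_tendsto_zero]
    exact squeeze_zero' (Eventually.of_forall fun _ => norm_nonneg _) hK
      (tendsto_const_nhds.div_atTop hy)
  have hv0 : ∀ᶠ t in l, v t ≠ 0 := by
    filter_upwards [hq.eventually_ne (show (2 / 5 : ℂ) ≠ 0 by norm_num)] with t ht h
    exact ht (by simp [h])
  have hu : Tendsto (fun t => rootCoord (y t) (v t)) l (𝓝 0) := by
    have h1 : Tendsto (fun t => ‖rootCoord (y t) (v t)‖ ^ 2) l (𝓝 0) := by
      refine (tendsto_inv_atTop_zero.comp hy).congr' ?_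
      filter_upwards [hy2, hv0] with t h1 h2
      rw [← norm_pow, rootCoord_sq (norm_pos_iff.1 (by linarith)) h2]
      simp
    have h2 := h1.sqrt
    simp only [Real.sqrt_sq (norm_nonneg _), Real.sqrt_zero] at h2
    exact tendsto_zero_iff_norm_tendsto_zero.2 h2
  refine ⟨hu, ?_⟩
  have hshift : Tendsto (fun t => (J t).shift (rootCoord (y t) (v t))) l (𝓝 0) := by
    have hu' : Tendsto (fun t => 3 * M * ‖rootCoord (y t) (v t)‖) l (𝓝 0) := by
      simpa using hu.norm.const_mul (3 * M)
    refine squeeze_zero_norm' ?_ hu'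
    have hu1 : ∀ᶠ t in l, ‖rootCoord (y t) (v t)‖ < 1 := by
      have := hu.norm
      rw [norm_zero] at this
      exact this.eventually_lt_const one_pos
    filter_upwards [hM, hu1] with t h1 h2
    exact CoeffJet.norm_shift_le h1 h2.le
  have hcpow : Tendsto (fun t => (v t ^ 2 / y t ^ 5) ^ (2⁻¹ : ℂ)) l
      (𝓝 ((2 / 5 : ℂ) ^ (2⁻¹ : ℂ))) :=
    hq.cpow tendsto_const_nhds two_fifths_mem_slitPlane
  have hre : Tendsto (fun t => ((v t ^ 2 / y t ^ 5) ^ (2⁻¹ : ℂ) +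
      (J t).shift (rootCoord (y t) (v t))).re) l (𝓝 ((2 / 5 : ℂ) ^ (2⁻¹ : ℂ)).re) := by
    have := (Complex.continuous_re.tendsto _).comp (hcpow.add hshift)
    simpa [Function.comp_def] using this
  have hpos : 0 < ((2 / 5 : ℂ) ^ (2⁻¹ : ℂ)).re := by
    have h1 : ((2 / 5 : ℂ) ^ (2⁻¹ : ℂ)) = (((2 / 5 : ℝ) ^ (2⁻¹ : ℝ) : ℝ) : ℂ) := by
      rw [Complex.ofReal_cpow (by norm_num)]
      norm_num
    rw [h1, Complex.ofReal_re]
    positivity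
  filter_upwards [hy2, hv0, hq.eventually (Complex.isOpen_slitPlane.mem_nhds
    two_fifths_mem_slitPlane), hre.eventually_const_lt hpos] with t h1 h2 h3 h4
  exact ⟨h1, h2, h3, h4⟩

open Metric in
/-- If the continuation along `p` is inverted by a function `Z` of the coordinate `u`, regular at
`u = 0` and ramified of order three there, then it has an expansion in cube roots. -/
theorem hasRootExpansionAtEnd_of_inverse {p : ℝ → ℂ} {f : ℝ → ℂ → ℂ} {Z m : ℂ → ℂ} {u : ℝ → ℂ}
    {t₀ : ℝ} (ht₀ : t₀ ∈ Ico (0 : ℝ) 1) (hZ : AnalyticAt ℂ Z 0) (hm : AnalyticAt ℂ m 0)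
    (hm0 : m 0 ≠ 0) (hd : ∀ᶠ u in 𝓝 0, deriv Z u = u ^ 2 * m u)
    (hu : ContinuousOn u (Ico t₀ 1)) (hu0 : ∀ t ∈ Ico t₀ 1, u t ≠ 0)
    (hulim : Tendsto u (𝓝[<] 1) (𝓝 0)) (hp : Tendsto p (𝓝[<] 1) (𝓝 (p 1)))
    (hZu : ∀ t ∈ Ico t₀ 1, Z (u t) = p t)
    (hf : ∀ t ∈ Ico t₀ 1, ∀ᶠ w in 𝓝 (u t), w ^ 2 * f t (Z w) = 1) :
    HasRootExpansionAtEnd 3 2 p f := by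
  have hIco : ∀ᶠ t in 𝓝[<] (1 : ℝ), t ∈ Ico t₀ 1 := Ico_mem_nhdsLT ht₀.2
  have hZ0 : Z 0 = p 1 := by
    refine tendsto_nhds_unique (hZ.continuousAt.tendsto.comp hulim) (hp.congr' ?_)
    filter_upwards [hIco] with t ht using (hZu t ht).symm
  obtain ⟨ω, hω, hω0, hωd, hZω⟩ := hZ.exists_eq_add_pow_three hm hm0 hd
  obtain ⟨s, hs, hs0, hsl, hsr⟩ := hω.exists_inverse_coordinate hω0 hωd
  -- A disc in `w` on which the expansion is valid.
  obtain ⟨r, hr, hrb⟩ := Metric.eventually_nhds_iff_ball.1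
    (hs.eventually_analyticAt.and (hs.continuousAt.eventually_ne hs0))
  have hws : Tendsto (fun w => w * s w) (𝓝 0) (𝓝 0) := by
    have : ContinuousAt (fun w => w * s w) 0 := continuousAt_id.mul hs.continuousAt
    simpa [ContinuousAt] using this
  have hωlim : Tendsto ω (𝓝 0) (𝓝 0) := by simpa [hω0] using hω.continuousAt.tendsto
  -- The conditions on `u` and on `w = ω u` that hold close to the end of the path.
  have hgood : ∀ᶠ x in 𝓝 (0 : ℂ), (AnalyticAt ℂ ω x ∧ Z x = p 1 + ω x ^ 3 ∧ ω x * s (ω x) = x) ∧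
      (ω x ∈ ball 0 r ∧ ∀ᶠ w in 𝓝 (ω x), ω (w * s w) = w ∧ Z (w * s w) = Z 0 + ω (w * s w) ^ 3) := by
    rw [← hZ0]
    exact (hω.eventually_analyticAt.and (hZω.and hsl)).and
      ((hωlim.eventually (ball_mem_nhds 0 hr)).and
        (hωlim.eventually (hsr.and (hws.eventually hZω)).eventually_nhds))
  obtain ⟨t₁, ht₁, ht₁b⟩ := (mem_nhdsLT_iff_exists_Ico_subset).1 ((hulim.eventually hgood).and hIco)
  set t₂ := max t₀ t₁ with ht₂
  have ht₂1 : t₂ < 1 := max_lt ht₀.2 ht₁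
  have hsub : ∀ t ∈ Ico t₂ 1, t ∈ Ico t₁ 1 ∧ t ∈ Ico t₀ 1 := fun t ht =>
    ⟨⟨(le_max_right _ _).trans ht.1, ht.2⟩, ⟨(le_max_left _ _).trans ht.1, ht.2⟩⟩
  refine ⟨fun w => (s w ^ 2)⁻¹, r, hr, ?_, inv_ne_zero (pow_ne_zero 2 hs0), t₂,
    ⟨ht₀.1.trans (le_max_left _ _), ht₂1⟩, fun t => ω (u t), ?_, ?_⟩
  · intro w hw
    exact (((hrb w hw).1.differentiableAt.pow 2).inv
      (pow_ne_zero 2 (hrb w hw).2)).differentiableWithinAt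
  · intro t ht
    obtain ⟨h1, h0⟩ := hsub t ht
    exact (ht₁b h1).1.1.1.continuousAt.comp_continuousWithinAt
      ((hu t h0).mono fun x hx => (hsub x hx).2)
  intro t ht
  obtain ⟨h1, h0⟩ := hsub t ht
  obtain ⟨⟨-, e1, e2⟩, e3, e4⟩ := (ht₁b h1).1
  have hω0 : ω (u t) ≠ 0 := fun h => hu0 t h0 (by rw [← e2, h, zero_mul])
  refine ⟨hω0, by simpa using e3, by rw [← hZu t h0, e1], ?_⟩
  have hlim : Tendsto (fun w => w * s w) (𝓝 (ω (u t))) (𝓝 (u t)) := by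
    have : ContinuousAt (fun w => w * s w) (ω (u t)) :=
      continuousAt_id.mul (hrb _ e3).1.continuousAt
    simpa [ContinuousAt, e2] using this
  filter_upwards [e4, hlim.eventually (hf t h0), isOpen_ball.mem_nhds e3] with w h3 h4 h5
  have h6 := (hrb w h5).2
  rw [← hZ0]
  rw [h3.2, h3.1] at h4
  field_simp
  linear_combination h4

open Metric in
/-- A solution that tends to infinity with bounded modified energy has a cube-root expansion. The
regular system has a solution through a late state on a disc that contains `u = 0`; its component
`Z` inverts the coordinate `u` at that state, hence, by continuation, on the rest of the path. -/
theorem IsSolutionFrom.hasRootExpansionAtEnd {t₀ : ℝ} {p : ℝ → ℂ}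
    {f : ℝ → ℂ → ℂ} (h : IsSolutionFrom a b β γ t₀ p f) (ht₀ : t₀ ∈ Ico (0 : ℝ) 1)
    (hp : ContinuousOn p (Icc t₀ 1))
    (hβ : AnalyticAt ℂ β (p 1)) (hγ : AnalyticAt ℂ γ (p 1)) {B : ℝ}
    (hlim : Tendsto (fun t => rootCoord (f t (p t)) (deriv (f t) (p t))) (𝓝[<] 1) (𝓝 0))
    (hn : ∀ t ∈ Ico t₀ 1, (coeffJet a b β γ (p t)).NearPole (f t (p t)) (deriv (f t) (p t)))
    (hB : ∀ t ∈ Ico t₀ 1, ‖(coeffJet a b β γ (p t)).modEnergy (f t (p t)) (deriv (f t) (p t))‖ ≤ B) :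
    HasRootExpansionAtEnd 3 2 p f := by
  set X : ℝ → ℂ → ℂ × ℂ × ℂ := fun t z => poleState a b β γ z (f t z) (deriv (f t) z) with hX
  have hIco : ∀ᶠ t in 𝓝[<] (1 : ℝ), t ∈ Ico t₀ 1 := Ico_mem_nhdsLT ht₀.2
  have hpIco : ContinuousOn p (Ico t₀ 1) := hp.mono Ico_subset_Icc_self
  have hp1 : Tendsto p (𝓝[<] 1) (𝓝 (p 1)) := by
    rw [Metric.tendsto_nhds]
    exact fun ε hε => eventually_dist_right_end_lt ht₀.2 hp hε
  -- The state has a limit point `(0, p 1, W₁)`.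
  have hWB : ∀ᶠ t in 𝓝[<] (1 : ℝ), (X t (p t)).2.2 ∈ closedBall (0 : ℂ) B := by
    filter_upwards [hIco] with t ht
    have := hB t ht
    simpa [hX, poleState, CoeffJet.modEnergy, cutoff_eq_one (hn t ht).two_lt] using this
  obtain ⟨W₁, -, hcl⟩ := (isCompact_closedBall (0 : ℂ) B).exists_mapClusterPt_of_frequently
    hWB.frequently
  obtain ⟨hsl, hfield⟩ := analyticAt_slope_and_poleField (a := a) (b := b)
    (x := ((0, p 1, W₁) : ℂ × ℂ × ℂ)) rfl hβ hγ
  set S : ℂ × ℂ × ℂ → ℂ := fun x => (coeffJet a b β γ x.2.1).slope x.1 x.2.2 with hS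
  have hU : ∀ᶠ x in 𝓝 ((0, p 1, W₁) : ℂ × ℂ × ℂ),
      AnalyticAt ℂ (poleField a b β γ) x ∧ AnalyticAt ℂ S x ∧ S x ≠ 0 :=
    hfield.eventually_analyticAt.and (hsl.eventually_analyticAt.and
      (hsl.continuousAt.eventually_ne (slope_zero_ne_zero _ _)))
  obtain ⟨ρ, hρ, N, hN, hsol⟩ := exists_uniform_holomorphic_solution hfield hU
  rw [nhds_prod_eq, mem_prod_iff] at hN
  obtain ⟨N₁, hN₁, N', hN', hNsub⟩ := hN
  rw [nhds_prod_eq, mem_prod_iff] at hN'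
  obtain ⟨N₂, hN₂, N₃, hN₃, hNsub'⟩ := hN'
  obtain ⟨t₁, ht₁, ht₁b⟩ := (mem_nhdsLT_iff_exists_Ico_subset).1
    ((hlim.eventually hN₁).and ((hp1.eventually hN₂).and
      ((hlim.eventually (ball_mem_nhds 0 (half_pos hρ))).and hIco)))
  obtain ⟨t₂, hW₂, ht₂⟩ := ((hcl.frequently hN₃).and_eventually
    (Ico_mem_nhdsLT (show t₁ < 1 from ht₁))).exists
  have ht₂I : t₂ ∈ Ico t₀ 1 := (ht₁b ht₂).2.2.2
  set u : ℝ → ℂ := fun t => (X t (p t)).1 with hu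
  have hu_small : ∀ t ∈ Ico t₂ 1, ‖u t‖ < ρ / 2 := fun t ht =>
    mem_ball_zero_iff.1 (ht₁b ⟨ht₂.1.trans ht.1, ht.2⟩).2.2.1
  have hsubI : Ico t₂ 1 ⊆ Ico t₀ 1 := Ico_subset_Ico_left ht₂I.1
  obtain ⟨φ, hφ0, hφ⟩ := hsol (X t₂ (p t₂))
    (hNsub ⟨(ht₁b ht₂).1, hNsub' ⟨(ht₁b ht₂).2.1, hW₂⟩⟩)
  -- The solution of the regular system, as a function of `u`.
  set Ψ : ℂ → ℂ × ℂ × ℂ := fun x => φ (x - u t₂) with hΨ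
  have hΨd : ∀ x ∈ ball (u t₂) ρ, HasDerivAt Ψ (poleField a b β γ (Ψ x)) x ∧
      AnalyticAt ℂ (poleField a b β γ) (Ψ x) ∧ AnalyticAt ℂ S (Ψ x) ∧ S (Ψ x) ≠ 0 := by
    intro x hx
    have hx' : x - u t₂ ∈ ball (0 : ℂ) ρ := by simpa [dist_eq_norm] using hx
    exact ⟨(hφ _ hx').1.comp_sub_const x (u t₂), (hφ _ hx').2⟩
  have hΨan : AnalyticOnNhd ℂ Ψ (ball (u t₂) ρ) := DifferentiableOn.analyticOnNhd
    (fun x hx => (hΨd x hx).1.differentiableAt.differentiableWithinAt) isOpen_ball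
  have hΨ2 : Ψ (u t₂) = X t₂ (p t₂) := by simp [hΨ, hφ0]
  have hmem : ∀ x : ℂ, ‖x‖ < ρ / 2 → x ∈ ball (u t₂) ρ := fun x hx => by
    rw [mem_ball, dist_eq_norm]
    have := norm_sub_le x (u t₂)
    have := hu_small t₂ ⟨le_rfl, ht₂I.2⟩
    linarith
  have h0mem : (0 : ℂ) ∈ ball (u t₂) ρ := hmem 0 (by simpa using half_pos hρ)
  have hΨ1 : ∀ x ∈ ball (u t₂) ρ, (Ψ x).1 = x := by
    intro x hx
    have hd : ∀ x ∈ ball (u t₂) ρ, HasDerivWithinAt (fun x => (Ψ x).1 - x) 0 (ball (u t₂) ρ) x := by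
      intro x hx
      have h1 : HasDerivAt (fun x => (Ψ x).1) 1 x := (hΨd x hx).1.fst
      simpa using (h1.fun_sub (hasDerivAt_id' x)).hasDerivWithinAt
    have h1 := Convex.norm_image_sub_le_of_norm_hasDerivWithin_le (C := 0) hd
      (fun _ _ => by simp) (convex_ball (u t₂) ρ) (mem_ball_self hρ) hx
    have h2 : (Ψ (u t₂)).1 = u t₂ := by rw [hΨ2]
    simpa [h2, sub_eq_zero] using h1
  set Z : ℂ → ℂ := fun x => (Ψ x).2.1 with hZdef
  have hZan : AnalyticOnNhd ℂ Z (ball (u t₂) ρ) := DifferentiableOn.analyticOnNhd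
    (fun x hx => ((hΨd x hx).1.differentiableAt.snd.fst).differentiableWithinAt) isOpen_ball
  have hZd : ∀ x ∈ ball (u t₂) ρ, deriv Z x = x ^ 2 * (-2 / S (Ψ x)) := by
    intro x hx
    have h1 : HasDerivAt Z (poleField a b β γ (Ψ x)).2.1 x := (hΨd x hx).1.snd.fst
    rw [h1.deriv]
    simp only [poleField, hΨ1 x hx, hS]
    ring
  -- The states along the path satisfy the same system, reparametrized by `z`.
  have hXd : ∀ t ∈ Ico t₀ 1, ∀ᶠ z in 𝓝 (p t), HasDerivAt (X t)
      ((-(deriv (f t) z * (X t z).1 ^ 3) / 2) • poleField a b β γ (X t z)) z ∧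
        (coeffJet a b β γ z).NearPole (f t z) (deriv (f t) z) := by
    intro t ht
    have hf := (h.continuation t ht).1
    filter_upwards [h.eventually_hasDerivAt ht, hf.eventually_analyticAt,
      (h.analyticAt_left t ht).eventually_analyticAt,
      (h.analyticAt_right t ht).eventually_analyticAt,
      eventually_nearPole (h.analyticAt_left t ht) (h.analyticAt_right t ht) hf.continuousAt
        hf.deriv.continuousAt (hn t ht)] with z h1 h2 h3 h4 h5
    exact ⟨hasDerivAt_poleState h3 h4 h2 h2.deriv h1.1 h1.2 h5, h5⟩
  have hXcont : IsContinuationFrom t₀ p (fun t z => (X t z).1) := by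
    intro t ht
    have hf := (h.continuation t ht).1
    refine ⟨hf.rootCoord hf.deriv (hn t ht).left_ne_zero (hn t ht).ne_zero
      (hn t ht).mem_slitPlane, ?_⟩
    filter_upwards [(h.continuation t ht).2] with s hs
    filter_upwards [hs, hs.deriv] with z h1 h2
    simp only [hX, poleState, h1, h2]
  have hucont : ContinuousOn u (Ico t₀ 1) := hXcont.continuousOn hpIco
  have hinv₂ : (fun z => Ψ (X t₂ z).1) =ᶠ[𝓝 (p t₂)] X t₂ := by
    have hcX : ContinuousAt (fun z => (X t₂ z).1) (p t₂) := (hXcont t₂ ht₂I).1.continuousAt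
    refine eventuallyEq_of_hasDerivAt_smul (Φ := poleField a b β γ)
      (k := fun z => -(deriv (f t₂) z * (X t₂ z).1 ^ 3) / 2) ?_ ?_ ?_ ?_ hΨ2
    · exact (hΨd _ (mem_ball_self hρ)).2.1
    · exact (((h.continuation t₂ ht₂I).1.deriv.continuousAt.mul (hcX.pow 3)).neg).div_const 2
    · filter_upwards [hXd t₂ ht₂I, hcX.eventually_mem (ball_mem_nhds _ hρ)] with z h1 h2
      have h3 := (hΨd _ h2).1.scomp z h1.1.fst
      simpa [poleField, Function.comp_def] using h3
    · exact (hXd t₂ ht₂I).mono fun z hz => hz.1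
  have hZcont : IsContinuationFrom t₂ p (fun t z => Z (X t z).1) := by
    intro t ht
    refine ⟨(hZan _ (hmem _ (hu_small t ht))).comp_of_eq (hXcont t (hsubI ht)).1 rfl, ?_⟩
    filter_upwards [((hXcont.mono ht₂I.1) t ht).2] with s hs
    filter_upwards [hs] with z hz
    simp only [hz]
  have hidcont : IsContinuationFrom t₂ p (fun _ z => z) := fun t _ =>
    ⟨analyticAt_id, Eventually.of_forall fun _ => EventuallyEq.rfl⟩
  have hinv : ∀ t ∈ Ico t₂ 1, (fun z => Z (X t z).1) =ᶠ[𝓝 (p t)] fun z => z := by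
    intro t ht
    refine hZcont.eventuallyEq hidcont (hpIco.mono hsubI) ⟨le_rfl, ht₂I.2⟩ ?_ ht
    filter_upwards [hinv₂] with z hz
    exact congrArg (fun x : ℂ × ℂ × ℂ => x.2.1) hz
  have hu0 : ∀ t ∈ Ico t₀ 1, u t ≠ 0 := fun t ht =>
    rootCoord_ne_zero (hn t ht).left_ne_zero (hn t ht).ne_zero
  refine hasRootExpansionAtEnd_of_inverse (Z := Z) (m := fun x => -2 / S (Ψ x)) (u := u)
    ⟨ht₀.1.trans ht₂I.1, ht₂I.2⟩ (hZan 0 h0mem) ?_ ?_ ?_ (hucont.mono hsubI)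
    (fun t ht => hu0 t (hsubI ht)) hlim hp1 (fun t ht => (hinv t ht).self_of_nhds) ?_
  · exact analyticAt_const.fun_div ((hΨd 0 h0mem).2.2.1.comp_of_eq (hΨan 0 h0mem) rfl)
      (hΨd 0 h0mem).2.2.2
  · exact div_ne_zero (by norm_num) (hΨd 0 h0mem).2.2.2
  · filter_upwards [isOpen_ball.mem_nhds h0mem] with x hx using hZd x hx
  · intro t ht
    -- `u` is a local coordinate at `p t`, so a property of all `z` near `p t` is one of all `u`.
    have hud : HasDerivAt (fun z => (X t z).1) _ (p t) :=
      (hXd t (hsubI ht)).self_of_nhds.1.fst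
    have hustrict := (hXcont t (hsubI ht)).1.hasStrictDerivAt
    have hne : deriv (fun z => (X t z).1) (p t) ≠ 0 := by
      rw [hud.deriv]
      simp only [Prod.smul_fst, poleField, smul_eq_mul, mul_one]
      exact div_ne_zero (neg_ne_zero.2 (mul_ne_zero (hn t (hsubI ht)).ne_zero
        (pow_ne_zero 3 (hu0 t (hsubI ht))))) two_ne_zero
    have hmap := hustrict.map_nhds_eq hne
    have hev : ∀ᶠ z in 𝓝 (p t), (X t z).1 ^ 2 * f t (Z (X t z).1) = 1 := by
      filter_upwards [hXd t (hsubI ht), hinv t ht] with z h1 h2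
      have h3 : Z (X t z).1 = z := h2
      have h4 : (X t z).1 ^ 2 = 1 / f t z := rootCoord_sq h1.2.left_ne_zero h1.2.ne_zero
      rw [h3, h4, one_div_mul_cancel h1.2.left_ne_zero]
    have : ∀ᶠ w in map (fun z => (X t z).1) (𝓝 (p t)), w ^ 2 * f t (Z w) = 1 :=
      eventually_map.2 hev
    rwa [hmap] at this

end

theorem proposition1 (Ω : Set ℂ) (hΩ : IsOpen Ω) (a b : ℂ) (β γ : ℂ → ℂ)
    (hβ : AnalyticOnNhd ℂ β Ω) (hγ : AnalyticOnNhd ℂ γ Ω) :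
    HasQuasiPainleveProperty 3 Ω
      (fun z y => y ^ 4 + (a * z + b) * y ^ 2 + β z * y + γ z) := by
  intro p f hp hbv hmaps hcont hsol hsing
  have hmem : ∀ t ∈ Ico (0 : ℝ) 1, p t ∈ Ω := fun t ht => hmaps (Ico_subset_Icc_self ht)
  have h1Ω : p 1 ∈ Ω := hmaps (right_mem_Icc.2 zero_le_one)
  have hS : IsSolutionFrom a b β γ 0 p f :=
    IsSolutionFrom.of_initial (hp.mono Ico_subset_Icc_self) hcont
      (fun t ht => hβ _ (hmem t ht)) (fun t ht => hγ _ (hmem t ht)) one_pos hsol.2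
  obtain ⟨M, hM⟩ := exists_boundedBy (a := a) (b := b) (hβ _ h1Ω) (hγ _ h1Ω)
  obtain ⟨ε, hε, hball⟩ := Metric.eventually_nhds_iff_ball.1 hM
  obtain ⟨t₁, ht₁, ht₁b⟩ := (mem_nhdsLT_iff_exists_Ico_subset).1
    ((eventually_dist_right_end_lt one_pos hp hε).and (Ico_mem_nhdsLT (one_pos (α := ℝ))))
  have hIco₁ : Ico t₁ 1 ⊆ Ico 0 1 := fun t ht => (ht₁b ht).2
  have ht₁0 : t₁ ∈ Ico (0 : ℝ) 1 := hIco₁ ⟨le_rfl, ht₁⟩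
  have hpt₁ : ContinuousOn p (Icc t₁ 1) := hp.mono (Icc_subset_Icc_left ht₁0.1)
  have hM₁ : ∀ t ∈ Ico t₁ 1, ∀ᶠ z in 𝓝 (p t), (coeffJet a b β γ z).BoundedBy M := fun t ht => by
    filter_upwards [Metric.isOpen_ball.mem_nhds (show p t ∈ Metric.ball (p 1) ε from
      (ht₁b ht).1)] with z hz using hball z hz
  have hS₁ := hS.mono ht₁0.1
  obtain ⟨B, hB⟩ := hS₁.exists_modEnergy_le (hpt₁.mono Ico_subset_Icc_self)
    (BoundedVariationOn.mono hbv (hIco₁.trans Ico_subset_Icc_self)) hM₁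
  have hinf := hS₁.tendsto_norm_atTop ht₁0.2 hpt₁ (hβ _ h1Ω) (hγ _ h1Ω)
    (fun t ht => (hM₁ t ht).self_of_nhds) hB hsing
  have hIco : ∀ᶠ t in 𝓝[<] (1 : ℝ), t ∈ Ico t₁ 1 := Ico_mem_nhdsLT ht₁0.2
  obtain ⟨hlim, hnear⟩ := tendsto_rootCoord_and_nearPole
    (hIco.mono fun t ht => (hM₁ t ht).self_of_nhds) (hIco.mono hB) hinf
  obtain ⟨t₂, ht₂, ht₂b⟩ := (mem_nhdsLT_iff_exists_Ico_subset).1 (hnear.and hIco)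
  have ht₂1 : t₁ ≤ t₂ := (ht₂b ⟨le_rfl, ht₂⟩).2.1
  exact ((hS₁.mono ht₂1).hasRootExpansionAtEnd ⟨ht₁0.1.trans ht₂1, ht₂⟩
    (hpt₁.mono (Icc_subset_Icc_left ht₂1)) (hβ _ h1Ω) (hγ _ h1Ω) hlim
    (fun t ht => (ht₂b ht).1) (fun t ht => hB t (ht₂b ht).2)).hasRootTypeAlgebraicPoleAtEnd
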